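/- **Setting.** Let $f:\mathbb R^{d_x}\times\mathbb R^{d_y}\to\mathbb R$, $d=d_x+d_y$, $z=(x,y)\in\mathbb R^d$, be twice continuously differentiable, with $\rho$-Lipschitz Hessian ($\|\nabla^2 f(z)-\nabla^2 f(z')\|\le\rho\|z-z'\|$, spectral norm, $\rho>0$), $\mu$-strongly convex in $x$ and $\mu$-strongly concave in $y$ ($\mu>0$), with saddle point $z^*$. Put $F(z)=(\nabla_x f(x,y),-\nabla_y f(x,y))$, let $\nabla F$ be its Jacobian, and let $\kappa=\rho/\mu$, $z_0\in\mathbb R^d$, $\beta=\|z_0-z^*\|$, $\varepsilon>0$. An $\varepsilon$-root is a point $\hat z$ with $\|\hat z-z^*\|\le\varepsilon$. **Cost model.** Arithmetic operations, square roots and comparisons of scalars cost $1$, an evaluation of $F$ costs $N$, an evaluation of $\nabla F$ costs $Nd$, and a Schur decomposition $A=QUQ^{-1}$ ($Q$ unitary, $U$ upper triangular) of a real $d\times d$ matrix costs at most $c_S d^3$. **Algorithm.** Let $1<\alpha<2$, $\eta_0>0$, $m\ge1$, $M=3\rho m$. LEN$(z_0,T,m,M)$ performs, for $t=0,\dots,T-1$: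 1. If $m\mid t$, compute $\nabla F(z_t)$ and its Schur decomposition $QUQ^{-1}$; otherwise keep the last $Q,U$. For $\eta>0$ let $z_t(\eta)=z_t-Q(U+\eta^{-1}I)^{-1}Q^{-1}F(z_t)$, computed by back substitution, and $\phi_t(\eta)=\eta\|z_t(\eta)-z_t\|$. 2. If $\|F(z_t(\eta_0))\|\le\mu\varepsilon$, halt the whole method and return $z_t(\eta_0)$. 3. Find $\eta_t$ with $\frac1{\alpha M}\le\phi_t(\eta_t)\le\frac1M$ (that is, $\gamma_t=\eta_t^{-1}$ satisfies $M\|z_t(\eta_t)-z_t\|\le\gamma_t\le\alpha M\|z_t(\eta_t)-z_t\|$) as follows: accept $\eta_0$ if it qualifies; otherwise, with $r=\|z_t(\eta_0)-z_t\|$, start from the bracket $[\eta_0,\frac1{Mr}]$ if $\phi_t(\eta_0)<\frac1{\alpha M}$ and from $[\frac1{\alpha Mr},\eta_0]$ if $\phi_t(\eta_0)>\frac1M$, and repeatedly test the geometric mean of the end points, replacing the upper end point by it if $\phi_t>\frac1M$ and the lower one if $\phi_t<\frac1{\alpha M}$, until it qualifies. 4. Put $z_{t+1/2}=z_t(\eta_t)$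 and $z_{t+1}=z_t-\eta_tF(z_{t+1/2})$. It returns $\big(\sum_t\eta_t\big)^{-1}\sum_t\eta_t z_{t+1/2}$. LEN-restart sets $z^{(0)}=z_0$ and $z^{(s+1)}=\mathrm{LEN}(z^{(s)},T,m,M)$ for $s=0,\dots,S-1$, and returns $z^{(S)}$ (unless it has halted in step 2). Set $$T=\Big\lceil\big(2M\beta/\mu\big)^{2/3}\Big\rceil,\qquad S=\Big\lceil\log_{3/2}\big(1+\max\{0,\log_{2/\alpha}(\beta/\varepsilon)\}\big)\Big\rceil .$$ **Statement.** For all constants $c_1>0$, $c_2$, $c_S$ and $1<\alpha<2$ there is $C>0$, depending only on them, such that for all $f$, $d_x,d_y$, $\rho,\mu,\varepsilon,\eta_0,z_0,N$ as above and every $m\ge1$ with $c_1d\le m\le c_2d$ (that is, $m=\Theta(d)$), LEN-restart terminates and returns an $\varepsilon$-root, at a total computational cost of at most $$C\,(N+d^2)\,\big(d+d^{2/3}(\kappa\beta)^{2/3}\big)\,\big(1+\log\log\Lambda\big)^2,\qquad \Lambda=3+d+\rho+\rho^{-1}+\mu^{-1}+\eta_0+\eta_0^{-1}+\beta+\varepsilon^{-1}.$$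 In particular, for bounded $\|z_0-z^*\|$ the total cost is $\tilde{\mathcal O}\big((N+d^2)(d+d^{2/3}\kappa^{2/3})\big)$. -/

import Mathlib

noncomputable section

namespace LEN

/-! ### Minimax problems -/

/-- `ℝⁿ` with the Euclidean norm. -/
abbrev Vec (n : ℕ) : Type := EuclideanSpace ℝ (Fin n)

/-- The `x`-block of the aggregated variable `z = (x, y)`. -/
def xPart {dx dy : ℕ} (z : Vec (dx + dy)) : Vec dx :=
  WithLp.toLp 2 fun i => z (Fin.castAdd dy i)

/-- The `y`-block of the aggregated variable `z = (x, y)`. -/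
def yPart {dx dy : ℕ} (z : Vec (dx + dy)) : Vec dy :=
  WithLp.toLp 2 fun j => z (Fin.natAdd dx j)

/-- `f` as a function of the aggregated variable `z = (x, y)`. -/
def joint {dx dy : ℕ} (f : Vec dx → Vec dy → ℝ) (z : Vec (dx + dy)) : ℝ :=
  f (xPart z) (yPart z)

/-- The GDA field `F(z) = (∇ₓ f(x, y), -∇_y f(x, y))`. -/
def gdaField {dx dy : ℕ} (f : Vec dx → Vec dy → ℝ) (z : Vec (dx + dy)) : Vec (dx + dy) :=
  WithLp.toLp 2 (Fin.append
    (fun i => gradient (fun x => f x (yPart z)) (xPart z) i)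
    (fun j => -gradient (fun y => f (xPart z) y) (yPart z) j))

/-- The Jacobian matrix `∇F(z)` of the GDA field. -/
def gdaJacobian {dx dy : ℕ} (f : Vec dx → Vec dy → ℝ) (z : Vec (dx + dy)) :
    Matrix (Fin (dx + dy)) (Fin (dx + dy)) ℝ :=
  Matrix.of fun i j => fderiv ℝ (gdaField f) z (EuclideanSpace.single j 1) i

/-- The Hessian of `f`, as an operator on `ℝᵈ`, is `ρ`-Lipschitz in the operator norm. -/
def HasLipschitzHessian {dx dy : ℕ} (ρ : ℝ) (f : Vec dx → Vec dy → ℝ) : Prop :=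
  ∀ z z' : Vec (dx + dy),
    ‖fderiv ℝ (gradient (joint f)) z - fderiv ℝ (gradient (joint f)) z'‖ ≤ ρ * ‖z - z'‖

/-- `f` is `μ`-strongly convex in `x` and `μ`-strongly concave in `y`. -/
def StronglyConvexConcave {dx dy : ℕ} (μ : ℝ) (f : Vec dx → Vec dy → ℝ) : Prop :=
  (∀ (x x' : Vec dx) (y : Vec dy),
    f x y + inner ℝ (x' - x) (gradient (fun u => f u y) x) + μ / 2 * ‖x - x'‖ ^ 2 ≤ f x' y) ∧
  (∀ (x : Vec dx) (y y' : Vec dy),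
    f x y' ≤ f x y + inner ℝ (y' - y) (gradient (fun v => f x v) y) - μ / 2 * ‖y - y'‖ ^ 2)

/-- `z = (x, y)` is a saddle point of `f`. -/
def IsSaddlePoint {dx dy : ℕ} (f : Vec dx → Vec dy → ℝ) (z : Vec (dx + dy)) : Prop :=
  ∀ (x : Vec dx) (y : Vec dy),
    f (xPart z) y ≤ f (xPart z) (yPart z) ∧ f (xPart z) (yPart z) ≤ f x (yPart z)

/-! ### Computations with a cost -/

/-- The ways in which a piece of a program can end: with an intermediate value, by halting the whole
program with the final answer `z`, or not at all within the allowed number of loop passes. -/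
inductive Outcome (V α : Type) : Type
  | value (a : α)
  | halt (z : V)
  | running

/-- A computation: its outcome and the total cost of the operations it has performed. -/
structure Run (V α : Type) : Type where
  outcome : Outcome V α
  cost : ℕ

/-- An operation of cost `k` with value `a`. -/
def charge {V α : Type} (k : ℕ) (a : α) : Run V α := ⟨.value a, k⟩

/-- Sequential composition; costs add up, and nothing is executed after a halt. -/
def Run.andThen {V α β : Type} (p : Run V α) (q : α → Run V β) : Run V β :=
  match p.outcome with
  | .value a => ⟨(q a).outcome, p.cost + (q a).cost⟩
  | .halt z => ⟨.halt z, p.cost⟩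
  | .running => ⟨.running, p.cost⟩

instance (V : Type) : Monad (Run V) where
  pure a := charge 0 a
  bind := Run.andThen

/-- The point returned by a complete program, if it has terminated. -/
def Run.result {V : Type} (p : Run V V) : Option V :=
  match p.outcome with
  | .value z => some z
  | .halt z => some z
  | .running => none

/-! ### LEN-restart

Cost model: every arithmetic operation, square root and comparison of scalars costs `1`, an
evaluation of `F` costs `N`, an evaluation of `∇F` costs `N d`, and a Schur decomposition has its
own cost, see `IsSchurRoutine`. -/

/-- Complex `d × d` matrices. -/
abbrev CMat (d : ℕ) : Type := Matrix (Fin d) (Fin d) ℂ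

/-- `schur A = (Q, U)` is, for every real matrix `A`, a Schur decomposition `A = Q U Q⁻¹` with `Q`
unitary and `U` upper triangular, and it is computed at a cost of at most `c d³`. -/
def IsSchurRoutine {d : ℕ} (c : ℕ) (schur : Matrix (Fin d) (Fin d) ℝ → CMat d × CMat d)
    (schurCost : Matrix (Fin d) (Fin d) ℝ → ℕ) : Prop :=
  ∀ A : Matrix (Fin d) (Fin d) ℝ,
    (schur A).1 ∈ Matrix.unitaryGroup (Fin d) ℂ ∧
    (∀ i j, j < i → (schur A).2 i j = 0) ∧
    A.map Complex.ofReal = (schur A).1 * (schur A).2 * (schur A).1⁻¹ ∧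
    schurCost A ≤ c * d ^ 3

/-- The data that the method works with. -/
structure Config (d : ℕ) : Type where
  /-- the oracle `F` -/
  F : Vec d → Vec d
  /-- the oracle `∇F` -/
  J : Vec d → Matrix (Fin d) (Fin d) ℝ
  /-- the cost of one evaluation of `F` -/
  N : ℕ
  /-- the Schur decomposition routine -/
  schur : Matrix (Fin d) (Fin d) ℝ → CMat d × CMat d
  /-- the cost of the Schur decomposition routine -/
  schurCost : Matrix (Fin d) (Fin d) ℝ → ℕ
  /-- the number of iterations between two snapshots -/
  m : ℕ
  /-- the regularization parameter -/
  M : ℝ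
  /-- the relative accuracy of the binary search -/
  α : ℝ
  /-- the first trial step size of the binary search -/
  η₀ : ℝ
  /-- a point `z` with `‖F z‖ ≤ tol` is returned as the answer -/
  tol : ℝ
  /-- the allowed number of passes through each binary search loop -/
  fuel : ℕ

variable {d : ℕ}

/-- Evaluate `F`. -/
def callF (P : Config d) (z : Vec d) : Run (Vec d) (Vec d) := charge P.N (P.F z)

/-- Evaluate `∇F`. -/
def callJ (P : Config d) (z : Vec d) : Run (Vec d) (Matrix (Fin d) (Fin d) ℝ) :=
  charge (P.N * d) (P.J z)

/-- Compute a Schur decomposition. -/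
def callSchur (P : Config d) (A : Matrix (Fin d) (Fin d) ℝ) : Run (Vec d) (CMat d × CMat d) :=
  charge (P.schurCost A) (P.schur A)

def vecAdd (x y : Vec d) : Run (Vec d) (Vec d) := charge d (x + y)

def vecSub (x y : Vec d) : Run (Vec d) (Vec d) := charge d (x - y)

def vecSmul (a : ℝ) (x : Vec d) : Run (Vec d) (Vec d) := charge d (a • x)

def vecNorm (x : Vec d) : Run (Vec d) ℝ := charge (2 * d) ‖x‖

/-- Back substitution for an upper triangular system `V x = b`: for `i = d - 1, …, 0` set
`x i = (b i - ∑ j > i, V i j * x j) / V i i`. -/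
def backSubst (V : CMat d) (b : Fin d → ℂ) : Run (Vec d) (Fin d → ℂ) :=
  (List.finRange d).reverse.foldlM
    (fun x i => charge (2 * (Finset.Ioi i).card + 1)
      (Function.update x i ((b i - ∑ j ∈ Finset.Ioi i, V i j * x j) / V i i)))
    0

/-- The regularized Newton step `z - Q (U + η⁻¹ I)⁻¹ Q⁻¹ b`, computed by two matrix-vector products
and one back substitution; `Q` is unitary, so that `Q⁻¹` is the conjugate transpose of `Q`. -/
def newtonStep (Q U : CMat d) (z b : Vec d) (η : ℝ) : Run (Vec d) (Vec d) := do
  let γ ← charge 1 η⁻¹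
  let c ← charge (3 * d ^ 2) (Q.conjTranspose.mulVec fun i => (b i : ℂ))
  let V ← charge d (U + (γ : ℂ) • (1 : CMat d))
  let x ← backSubst V c
  let h ← charge (2 * d ^ 2) (Q.mulVec x)
  vecSub z (WithLp.toLp 2 fun i => (h i).re)

/-- The binary search, in logarithmic scale, for a step size `η` in the bracket `[lo, hi]` with
`1 / (α M) ≤ η ‖z(η) - z‖ ≤ 1 / M`, where `z(η)` is the regularized Newton step. In terms of
`γ = η⁻¹` this is `M ‖z(η) - z‖ ≤ γ ≤ α M ‖z(η) - z‖`. Returns `z(η)` and `η`. -/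
def bisection (P : Config d) (Q U : CMat d) (z b : Vec d) : ℕ → ℝ → ℝ → Run (Vec d) (Vec d × ℝ)
  | 0, _, _ => ⟨.running, 0⟩
  | k + 1, lo, hi => do
    let η ← charge 2 √(lo * hi)
    let w ← newtonStep Q U z b η
    let e ← vecSub w z
    let r ← vecNorm e
    let p ← charge 1 (η * r)
    let u ← charge 1 (1 / P.M)
    let l ← charge 2 (1 / (P.α * P.M))
    let accept ← charge 2 (decide (l ≤ p ∧ p ≤ u))
    let big ← charge 1 (decide (u < p))
    if accept then charge 0 (w, η)
    else if big then bisection P Q U z b k lo η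
    else bisection P Q U z b k η hi

/-- The subproblem at `z`, with `b = F z` and snapshot Jacobian `Q U Q⁻¹`: one Newton step with the
trial step size `η₀` (if it meets the tolerance, the whole method halts there) which is accepted or
yields a bracket, and then the binary search. Returns `z_{t+1/2}` and `η_t = γ_t⁻¹`. -/
def subproblem (P : Config d) (Q U : CMat d) (z b : Vec d) : Run (Vec d) (Vec d × ℝ) := do
  let w ← newtonStep Q U z b P.η₀
  let g ← callF P w
  let n ← vecNorm g
  let done ← charge 1 (decide (n ≤ P.tol))
  if done then (⟨.halt w, 0⟩ : Run (Vec d) (Vec d × ℝ))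
  else do
    let e ← vecSub w z
    let r ← vecNorm e
    let p ← charge 1 (P.η₀ * r)
    let u ← charge 1 (1 / P.M)
    let l ← charge 2 (1 / (P.α * P.M))
    let accept ← charge 2 (decide (l ≤ p ∧ p ≤ u))
    let small ← charge 1 (decide (p < l))
    if accept then charge 0 (w, P.η₀)
    else if small then do
      let hi ← charge 2 (1 / (P.M * r))
      bisection P Q U z b P.fuel P.η₀ hi
    else do
      let lo ← charge 3 (1 / (P.α * P.M * r))
      bisection P Q U z b P.fuel lo P.η₀

/-- The memory of LEN between two iterations: the current iterate, the Schur factors at the last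
snapshot, `∑ η_t z_{t+1/2}` and `∑ η_t`. -/
structure Memory (d : ℕ) : Type where
  z : Vec d
  Q : CMat d
  U : CMat d
  acc : Vec d
  weight : ℝ

/-- The Schur factors used in iteration `t`: new ones if `m` divides `t`, else the stored ones. -/
def snapshot (P : Config d) (t : ℕ) (s : Memory d) : Run (Vec d) (CMat d × CMat d) := do
  let new ← charge 2 (decide (t % P.m = 0))
  if new then do
    let A ← callJ P s.z
    callSchur P A
  else charge 0 (s.Q, s.U)

/-- Iteration `t` of LEN. -/
def lenIteration (P : Config d) (t : ℕ) (s : Memory d) : Run (Vec d) (Memory d) := do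
  let QU ← snapshot P t s
  let b ← callF P s.z
  let wη ← subproblem P QU.1 QU.2 s.z b
  let g ← callF P wη.1
  let v ← vecSmul wη.2 g
  let z' ← vecSub s.z v
  let y ← vecSmul wη.2 wη.1
  let acc ← vecAdd s.acc y
  let weight ← charge 1 (s.weight + wη.2)
  charge 0 ⟨z', QU.1, QU.2, acc, weight⟩

/-- The iterations `t, t + 1, …, t + n - 1` of LEN. -/
def lenLoop (P : Config d) : ℕ → ℕ → Memory d → Run (Vec d) (Memory d)
  | 0, _, s => charge 0 s
  | n + 1, t, s => do
    let s' ← lenIteration P t s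
    let t' ← charge 1 (t + 1)
    lenLoop P n t' s'

/-- `T` iterations of LEN from `z₀`, returning the average of the `z_{t+1/2}` with weights
`η_t = γ_t⁻¹`. -/
def len (P : Config d) (T : ℕ) (z₀ : Vec d) : Run (Vec d) (Vec d) := do
  let s ← lenLoop P T 0 ⟨z₀, 0, 0, 0, 0⟩
  let a ← charge 1 s.weight⁻¹
  vecSmul a s.acc

/-- LEN-restart: `S` epochs, each of which runs LEN for `T` iterations from the point returned by
the previous one. -/
def lenRestart (P : Config d) (T : ℕ) : ℕ → Vec d → Run (Vec d) (Vec d)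
  | 0, z => charge 0 z
  | S + 1, z => do
    let z' ← len P T z
    lenRestart P T S z'

/-- LEN-restart terminates with the answer `z` at total cost `c`: this is what happens as soon as
the bound on the number of passes through the binary search loops is large enough. -/
def TerminatesWith (P : Config d) (T S : ℕ) (z₀ z : Vec d) (c : ℕ) : Prop :=
  ∃ k₀ : ℕ, ∀ k ≥ k₀,
    (lenRestart { P with fuel := k } T S z₀).result = some z ∧
    (lenRestart { P with fuel := k } T S z₀).cost = c

/-- The number of iterations per epoch, `(2 M β / μ)^{2/3}` rounded up. -/
def numIters (M β μ : ℝ) : ℕ := ⌈(2 * M * β / μ) ^ (2 / 3 : ℝ)⌉₊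

/-- The number of epochs, `log_{3/2} (1 + log_{2/α} (β / ε))` rounded up, and `0` if `β ≤ ε`. -/
def numEpochs (α β ε : ℝ) : ℕ :=
  ⌈Real.logb (3 / 2) (1 + max 0 (Real.logb (2 / α) (β / ε)))⌉₊

end LEN

end

/-! One iteration is an inexact extragradient step. With w = z_{t+1/2}, the corrector displacement
z_{t+1} - w is -η times the error of linearizing F between z_t and w with the Jacobian at the last
snapshot. Acceptance gives η‖w - z_t‖ ≤ 1/(3ρm), so this displacement is at most 1/(3m) times the
path length since the snapshot, a sum of at most m terms (`IsTrajectory.norm_next_sub_le`). The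
lagged Gronwall inequality `sum_sq_le_of_le_window_average` then bounds the sum of squared corrector
displacements by 2/7 of the sum of squared steps, so the extragradient energy estimate survives the
stale Jacobians (`IsTrajectory.energy_le`).

The other half of the acceptance test, η‖w - z_t‖ ≥ 1/(αM), says that short steps have large step
sizes. Hence a bound on the sum of squared steps forces ∑ η to grow like n^{3/2}
(`IsTrajectory.cube_le`), and Jensen with strong monotonicity gives D'² ≤ (α/2) D³/β for the
distances D, D' to the root before and after an epoch. Iterated, the exponent of α/2 grows like
(3/2)^j (`IsSetup.lenRestart_spec`), so doubly logarithmically many epochs suffice.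

For the binary search let φ(η) = η‖z(η) - z‖. Monotonicity of the Jacobian gives φ(η')/φ(η) ≤
(η'/η)² for η ≤ η', so a bracket straddling the acceptance window has ratio at least √α, while every
rejected geometric mean halves the logarithm of the ratio (`bisection_spec`). The number of passes
is thus logarithmic in the logarithm of the initial ratio. That ratio is polynomial in Λ: the trial
step is bounded above a priori, and bounded below because a tiny step would have a residual small
enough to trigger the halt.

For the cost, the Schur factors make every trial step O(d²), and the O(Nd + d³) snapshots are
amortized over m ≍ d iterations (`epochCost_le`). The predicate `EventuallyRuns` is a Hoare triple
with a cost bound, which attaches these facts to the program. -/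

noncomputable section

namespace LEN

/-! ### Specifications of runs -/

section Specification

variable {V α β : Type}

/-- The runs `p k` agree for all `k ≥ k₀`, cost at most `c`, and end either with a value that
satisfies `Q` or with a halt at a point that satisfies `H`. -/
def EventuallyRuns (k₀ : ℕ) (H : V → Prop) (p : ℕ → Run V α) (c : ℕ) (Q : α → Prop) : Prop :=
  ∃ r : Run V α, (∀ k ≥ k₀, p k = r) ∧ r.cost ≤ c ∧
    ((∃ a, r.outcome = .value a ∧ Q a) ∨ ∃ z, r.outcome = .halt z ∧ H z)

variable {k₀ c c' : ℕ} {H : V → Prop} {Q : α → Prop} {R : β → Prop}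

theorem EventuallyRuns.mono {p : ℕ → Run V α} {Q' : α → Prop} (h : EventuallyRuns k₀ H p c Q)
    (hc : c ≤ c') (hQ : ∀ a, Q a → Q' a) : EventuallyRuns k₀ H p c' Q' := by
  obtain ⟨r, hr, hcost, ho⟩ := h
  refine ⟨r, hr, hcost.trans hc, ho.imp_left ?_⟩
  rintro ⟨a, ha, hQa⟩
  exact ⟨a, ha, hQ a hQa⟩

theorem EventuallyRuns.mono_cost {p : ℕ → Run V α} (h : EventuallyRuns k₀ H p c Q)
    (hc : c ≤ c') : EventuallyRuns k₀ H p c' Q :=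
  h.mono hc fun _ => id

/-- Sequencing rule of the Hoare logic. A halt skips the continuation, which is why both parts share
the same halting postcondition `H`. -/
theorem EventuallyRuns.bind {p : ℕ → Run V α} {q : ℕ → α → Run V β}
    (hp : EventuallyRuns k₀ H p c Q)
    (hq : ∀ a, Q a → EventuallyRuns k₀ H (fun k => q k a) c' R) :
    EventuallyRuns k₀ H (fun k => p k >>= q k) (c + c') R := by
  obtain ⟨r, hr, hcost, ⟨a, ha, hQ⟩ | ⟨z, hz, hH⟩⟩ := hp
  · obtain ⟨s, hs, hcost', ho⟩ := hq a hQ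
    refine ⟨⟨s.outcome, r.cost + s.cost⟩, fun k hk => ?_, by simpa using by omega, ho⟩
    have hs' : q k a = s := hs k hk
    change Run.andThen (p k) (q k) = _
    rw [hr k hk, Run.andThen, ha]
    simp [hs']
  · refine ⟨⟨.halt z, r.cost⟩, fun k hk => ?_, hcost.trans (Nat.le_add_right _ _), .inr ⟨z, rfl, hH⟩⟩
    change Run.andThen (p k) (q k) = _
    rw [hr k hk, Run.andThen, hz]

theorem EventuallyRuns.congr {p p' : ℕ → Run V α} (h : EventuallyRuns k₀ H p c Q)
    (hp : ∀ k ≥ k₀, p' k = p k) : EventuallyRuns k₀ H p' c Q := by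
  obtain ⟨r, hr, hcost, ho⟩ := h
  exact ⟨r, fun k hk => (hp k hk).trans (hr k hk), hcost, ho⟩

theorem EventuallyRuns.charge {a : α} (h : Q a) :
    EventuallyRuns k₀ H (fun _ => (charge c a : Run V α)) c Q :=
  ⟨LEN.charge c a, fun _ _ => rfl, le_rfl, .inl ⟨a, rfl, h⟩⟩

theorem EventuallyRuns.charge_bind {a : α} {q : ℕ → α → Run V β}
    (hq : EventuallyRuns k₀ H (fun k => q k a) c' R) :
    EventuallyRuns k₀ H (fun k => (LEN.charge c a : Run V α) >>= q k) (c + c') R :=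
  EventuallyRuns.bind (Q := fun x => x = a) (.charge rfl) (by rintro _ rfl; exact hq)

theorem EventuallyRuns.ite {b : Prop} [Decidable b] {p q : ℕ → Run V α}
    (hp : b → EventuallyRuns k₀ H p c Q) (hq : ¬b → EventuallyRuns k₀ H q c Q) :
    EventuallyRuns k₀ H (fun k => if b then p k else q k) c Q := by
  by_cases hb : b
  · simpa [hb] using hp hb
  · simpa [hb] using hq hb

end Specification

/-! ### Back substitution and the regularized Newton step -/

variable {d : ℕ}

/-- The charge of each step depends only on the index and not on the state, so value and cost of the
loop separate. -/
theorem foldlM_charge {V α ι : Type} (g : ι → ℕ) (h : α → ι → α) (l : List ι) (a : α) :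
    (l.foldlM (fun x i => (charge (g i) (h x i) : Run V α)) a) =
      charge (l.map g).sum (l.foldl h a) := by
  induction l generalizing a with
  | nil => rfl
  | cons i l ih =>
    rw [List.foldlM_cons]
    change Run.andThen _ _ = _
    simp only [ih]
    simp [Run.andThen, charge]

/-- The solution of the upper triangular system `V x = b` found by back substitution. -/
def backSubstValue (V : CMat d) (b : Fin d → ℂ) (l : List (Fin d)) : Fin d → ℂ :=
  l.foldr (fun i x => Function.update x i ((b i - ∑ j ∈ Finset.Ioi i, V i j * x j) / V i i)) 0

theorem backSubst_eq (V : CMat d) (b : Fin d → ℂ) :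
    backSubst V b = charge ((List.finRange d).reverse.map
      fun i => 2 * (Finset.Ioi i).card + 1).sum (backSubstValue V b (List.finRange d)) := by
  rw [backSubst, foldlM_charge, List.foldl_reverse]
  rfl

/-- Row i involves only entries with index at least i. The right fold over the increasing list fills
in larger indices first, and later updates touch only smaller ones, so a row once satisfied stays
satisfied. -/
theorem backSubstValue_spec (V : CMat d) (b : Fin d → ℂ) (hV : ∀ i, V i i ≠ 0) (l : List (Fin d))
    (hl : l.Pairwise (· < ·)) {i : Fin d} (hi : i ∈ l) :
    V i i * backSubstValue V b l i + ∑ j ∈ Finset.Ioi i, V i j * backSubstValue V b l j = b i := by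
  induction l with
  | nil => simp at hi
  | cons a l ih =>
    rw [List.pairwise_cons] at hl
    have hx : backSubstValue V b (a :: l) = Function.update (backSubstValue V b l) a
        ((b a - ∑ j ∈ Finset.Ioi a, V a j * backSubstValue V b l j) / V a a) := rfl
    have hsum : ∀ k, a ≤ k → ∑ j ∈ Finset.Ioi k, V k j * backSubstValue V b (a :: l) j =
        ∑ j ∈ Finset.Ioi k, V k j * backSubstValue V b l j := by
      intro k hk
      refine Finset.sum_congr rfl fun j hj => ?_
      rw [hx, Function.update_of_ne (hk.trans_lt (Finset.mem_Ioi.1 hj)).ne']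
    rcases List.mem_cons.1 hi with rfl | hi
    · rw [hsum i le_rfl, hx, Function.update_self, mul_div_cancel₀ _ (hV i)]
      ring
    · have hai := hl.1 i hi
      rw [hsum i hai.le, hx, Function.update_of_ne hai.ne', ih hl.2 hi]

theorem mulVec_backSubstValue (V : CMat d) (b : Fin d → ℂ) (hV : ∀ i, V i i ≠ 0)
    (htri : ∀ i j, j < i → V i j = 0) :
    V.mulVec (backSubstValue V b (List.finRange d)) = b := by
  funext i
  rw [← backSubstValue_spec V b hV (List.finRange d) (List.pairwise_lt_finRange d)
    (List.mem_finRange i)]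
  set x := backSubstValue V b (List.finRange d)
  have h : ∑ j, V i j * x j = ∑ j ∈ Finset.Ici i, V i j * x j := by
    symm
    refine Finset.sum_subset (Finset.subset_univ _) fun j _ hj => ?_
    rw [htri i j (by simpa using hj), zero_mul]
  rw [Matrix.mulVec, dotProduct, h, ← Finset.Ioi_insert, Finset.sum_insert (by simp)]

theorem backSubst_cost_le (d : ℕ) :
    ((List.finRange d).reverse.map fun i => 2 * (Finset.Ioi i).card + 1).sum ≤ d * (2 * d + 1) := by
  refine (List.sum_le_card_nsmul _ (2 * d + 1) ?_).trans (by simp)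
  intro x hx
  obtain ⟨i, -, rfl⟩ := List.mem_map.1 hx
  have := Finset.card_le_univ (Finset.Ioi i)
  simp only [Fintype.card_fin] at this
  omega

/-- The diagonal of a regularized Schur factor of a matrix without eigenvalue `-γ` has no zeros. -/
theorem schur_diag_ne_zero {A : Matrix (Fin d) (Fin d) ℝ} {Q U : CMat d} {γ : ℝ}
    (hQ : Q ∈ Matrix.unitaryGroup (Fin d) ℂ) (hU : ∀ i j, j < i → U i j = 0)
    (hA : A.map Complex.ofReal = Q * U * Q⁻¹)
    (hinj : ∀ v : Fin d → ℝ, A.mulVec v + γ • v = 0 → v = 0) (i : Fin d) :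
    (U + (γ : ℂ) • (1 : CMat d)) i i ≠ 0 := by
  have hdetQ : IsUnit Q.det := by
    rw [← Matrix.isUnit_iff_isUnit_det]
    exact IsUnit.of_mul_eq_one _ (Matrix.mem_unitaryGroup_iff.1 hQ)
  have hdet : (A + γ • (1 : Matrix (Fin d) (Fin d) ℝ)).det ≠ 0 := by
    intro h0
    obtain ⟨v, hv, hv0⟩ := Matrix.exists_mulVec_eq_zero_iff.2 h0
    refine hv (hinj v ?_)
    simpa [Matrix.add_mulVec, Matrix.smul_mulVec] using hv0
  have hmap : (A + γ • (1 : Matrix (Fin d) (Fin d) ℝ)).map Complex.ofReal =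
      Q * (U + (γ : ℂ) • (1 : CMat d)) * Q⁻¹ := by
    rw [mul_add, add_mul, ← hA]
    have : Q * ((γ : ℂ) • (1 : CMat d)) * Q⁻¹ = (γ : ℂ) • (1 : CMat d) := by
      rw [mul_smul_comm, smul_mul_assoc, mul_one, Matrix.mul_nonsing_inv _ hdetQ]
    rw [this]
    ext i j
    by_cases hij : i = j <;> simp [hij]
  -- The determinant is invariant under the Schur similarity, and that of the triangular factor is
  -- the product of its diagonal.
  have hdet' : (U + (γ : ℂ) • (1 : CMat d)).det ≠ 0 := by
    intro h0
    apply hdet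
    have h1 := congrArg Matrix.det hmap
    rw [Matrix.det_mul, Matrix.det_mul, h0, mul_zero, zero_mul] at h1
    have h2 : (A + γ • (1 : Matrix (Fin d) (Fin d) ℝ)).map Complex.ofReal =
      Complex.ofRealHom.mapMatrix (A + γ • (1 : Matrix (Fin d) (Fin d) ℝ)) := rfl
    rw [h2, ← RingHom.map_det] at h1
    simpa using h1
  rw [Matrix.det_of_isUpperTriangular (fun i j (hij : j < i) => by
    simp [hU i j hij, hij.ne'])] at hdet'
  exact Finset.prod_ne_zero_iff.1 hdet' i (Finset.mem_univ i)

/-- `w` is the regularized Newton step `z - (A + η⁻¹)⁻¹ b` from `z` with step size `η`. -/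
def IsNewtonStep (A : Vec d →L[ℝ] Vec d) (z b : Vec d) (η : ℝ) (w : Vec d) : Prop :=
  A (w - z) + η⁻¹ • (w - z) = -b

/-- Multiplication by a real matrix commutes with taking real parts. -/
theorem re_mulVec_map (A : Matrix (Fin d) (Fin d) ℝ) (h : Fin d → ℂ) (i : Fin d) :
    ((A.map Complex.ofReal).mulVec h i).re = A.mulVec (fun j => (h j).re) i := by
  simp [Matrix.mulVec, dotProduct]

/-- The complex vector found through the Schur factors solves a system with real matrix, real shift
and real right-hand side, so its real part solves it too. -/
theorem newtonStep_spec {A : Matrix (Fin d) (Fin d) ℝ} {L : Vec d →L[ℝ] Vec d} {Q U : CMat d}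
    {η : ℝ} (hL : ∀ v, L v = WithLp.toLp 2 (A.mulVec v.ofLp)) (hd : 0 < d)
    (hpos : ∀ v, 0 ≤ inner ℝ (L v) v) (hη : 0 < η)
    (hQ : Q ∈ Matrix.unitaryGroup (Fin d) ℂ) (hU : ∀ i j, j < i → U i j = 0)
    (hA : A.map Complex.ofReal = Q * U * Q⁻¹) (z b : Vec d) (k₀ : ℕ) (H : Vec d → Prop) :
    EventuallyRuns k₀ H (fun _ => newtonStep Q U z b η) (11 * d ^ 2)
      (IsNewtonStep L z b η) := by
  have hinj : ∀ v : Fin d → ℝ, A.mulVec v + η⁻¹ • v = 0 → v = 0 := by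
    intro v hv
    have h1 : L (WithLp.toLp 2 v) = -(η⁻¹ • WithLp.toLp 2 v) := by
      rw [hL, ← WithLp.toLp_smul, ← WithLp.toLp_neg]
      exact congrArg _ (eq_neg_of_add_eq_zero_left hv)
    have h2 := hpos (WithLp.toLp 2 v)
    rw [h1, inner_neg_left, real_inner_smul_left, real_inner_self_eq_norm_sq] at h2
    have h3 : ‖(WithLp.toLp 2 v : Vec d)‖ ^ 2 ≤ 0 := by
      by_contra! h4
      have := mul_pos (inv_pos.2 hη) h4
      linarith
    have h4 : (WithLp.toLp 2 v : Vec d) = 0 := by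
      rw [← norm_eq_zero]; nlinarith [norm_nonneg (WithLp.toLp 2 v : Vec d)]
    simpa using h4
  set γ := η⁻¹
  set V : CMat d := U + (γ : ℂ) • (1 : CMat d) with hVdef
  set bc : Fin d → ℂ := Q.conjTranspose.mulVec fun i => (b i : ℂ) with hbc
  have hx := mulVec_backSubstValue V bc
    (fun i => schur_diag_ne_zero hQ hU hA hinj i) (fun i j hij => by
      simp [hVdef, hU i j hij, hij.ne'])
  set x := backSubstValue V bc (List.finRange d) with hxdef
  have hQQ : Q * Q.conjTranspose = 1 := Matrix.mem_unitaryGroup_iff.1 hQ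
  have hQinv : Q⁻¹ = Q.conjTranspose := Matrix.inv_eq_right_inv hQQ
  have hQQ' : Q.conjTranspose * Q = 1 := Matrix.mem_unitaryGroup_iff'.1 hQ
  have hsol : (A.map Complex.ofReal).mulVec (Q.mulVec x) + (γ : ℂ) • Q.mulVec x =
      fun i => (b i : ℂ) := by
    have h1 : (A.map Complex.ofReal).mulVec (Q.mulVec x) = Q.mulVec (U.mulVec x) := by
      rw [hA, hQinv, Matrix.mulVec_mulVec, Matrix.mulVec_mulVec, mul_assoc, hQQ', mul_one]
    have h2 : (γ : ℂ) • Q.mulVec x = Q.mulVec ((γ : ℂ) • x) := by rw [Matrix.mulVec_smul]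
    have h3 : U.mulVec x + (γ : ℂ) • x = V.mulVec x := by
      rw [hVdef, Matrix.add_mulVec, Matrix.smul_mulVec, Matrix.one_mulVec]
    rw [h1, h2, ← Matrix.mulVec_add, h3, hx, hbc, Matrix.mulVec_mulVec, hQQ, Matrix.one_mulVec]
  unfold newtonStep
  -- The operations cost 7d² + 3d + 1 at most; the unused part of 11d² is assigned to the last one.
  rw [show 11 * d ^ 2 = 1 + (3 * d ^ 2 + (d + (d * (2 * d + 1) + (2 * d ^ 2 +
    (11 * d ^ 2 - 1 - 3 * d ^ 2 - d - d * (2 * d + 1) - 2 * d ^ 2))))) by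
    have : d ≤ d ^ 2 := by nlinarith
    have : d * (2 * d + 1) = 2 * d ^ 2 + d := by ring
    omega]
  refine .charge_bind (.charge_bind (.charge_bind (.bind (Q := fun y => y = x) ?_ ?_)))
  · rw [backSubst_eq]
    exact EventuallyRuns.mono_cost (.charge (Q := fun y => y = x) rfl) (backSubst_cost_le d)
  rintro _ rfl
  refine .charge_bind (EventuallyRuns.mono_cost (c := d) (.charge ?_) ?_)
  · have hsol' : A.mulVec (fun j => (Q.mulVec x j).re) + γ • (fun j => (Q.mulVec x j).re) =
        b.ofLp := by
      funext i
      have := congrArg Complex.re (congrFun hsol i)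
      rw [Pi.add_apply, Complex.add_re, re_mulVec_map] at this
      simpa using this
    have hsub : z - WithLp.toLp 2 (fun i => (Q.mulVec x i).re) - z =
        -(WithLp.toLp 2 (fun i => (Q.mulVec x i).re) : Vec d) := by abel
    rw [IsNewtonStep, hsub, map_neg, smul_neg, hL, ← neg_add, ← WithLp.toLp_smul,
      ← WithLp.toLp_add]
    exact congrArg _ (congrArg (WithLp.toLp 2) hsol')
  · have : d ≤ d ^ 2 := by nlinarith
    have : d * (2 * d + 1) = 2 * d ^ 2 + d := by ring
    omega

end LEN

namespace LEN

/-! ### Strongly monotone fields with a Lipschitz derivative -/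

/-- `F` is differentiable with a `ρ`-Lipschitz derivative, `μ`-strongly monotone, and has the
root `zs`. -/
structure IsRegularField {d : ℕ} (F : Vec d → Vec d) (ρ μ : ℝ) (zs : Vec d) : Prop where
  differentiable : Differentiable ℝ F
  lipschitz : ∀ z z', ‖fderiv ℝ F z - fderiv ℝ F z'‖ ≤ ρ * ‖z - z'‖
  monotone : ∀ z z', μ * ‖z - z'‖ ^ 2 ≤ inner ℝ (F z - F z') (z - z')
  root : F zs = 0

namespace IsRegularField

variable {d : ℕ} {F : Vec d → Vec d} {ρ μ : ℝ} {zs : Vec d}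

/-- Mean value inequality on the ball of radius R about p, where the derivative deviates from that
at p by at most ρR. The base point p need not be z: it will be a stale snapshot. -/
theorem norm_linearization_le (h : IsRegularField F ρ μ zs) (hρ : 0 ≤ ρ) {p z w : Vec d} {R : ℝ}
    (hz : ‖z - p‖ ≤ R) (hw : ‖w - p‖ ≤ R) :
    ‖F w - F z - fderiv ℝ F p (w - z)‖ ≤ ρ * R * ‖w - z‖ := by
  refine Convex.norm_image_sub_le_of_norm_hasFDerivWithin_le' (f' := fun x => fderiv ℝ F x)
    (s := Metric.closedBall p R) (fun x _ => (h.differentiable x).hasFDerivAt.hasFDerivWithinAt)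
    (fun x hx => ?_) (convex_closedBall p R) (mem_closedBall_iff_norm.2 hz)
    (mem_closedBall_iff_norm.2 hw)
  exact (h.lipschitz x p).trans (mul_le_mul_of_nonneg_left (mem_closedBall_iff_norm.1 hx) hρ)

/-- Strong monotonicity passes to the limit of the difference quotients. -/
theorem inner_fderiv_ge (h : IsRegularField F ρ μ zs) (z v : Vec d) :
    μ * ‖v‖ ^ 2 ≤ inner ℝ (fderiv ℝ F z v) v := by
  have hlim := Filter.Tendsto.inner (𝕜 := ℝ) ((h.differentiable z).hasFDerivAt.lim_real v)
    (tendsto_const_nhds (x := v))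
  refine ge_of_tendsto hlim ?_
  filter_upwards [Filter.eventually_gt_atTop (0 : ℝ)] with c hc
  have h1 := h.monotone (z + c⁻¹ • v) z
  rw [add_sub_cancel_left, norm_smul, real_inner_smul_right, mul_pow, Real.norm_eq_abs,
    sq_abs] at h1
  rw [real_inner_smul_left]
  have h2 := mul_le_mul_of_nonneg_left h1 (sq_nonneg c)
  have h3 : c ^ 2 * (μ * (c⁻¹ ^ 2 * ‖v‖ ^ 2)) = μ * ‖v‖ ^ 2 := by field_simp
  have h4 : c ^ 2 * (c⁻¹ * inner ℝ (F (z + c⁻¹ • v) - F z) v) =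
      c * inner ℝ (F (z + c⁻¹ • v) - F z) v := by field_simp
  linarith

theorem inner_fderiv_nonneg (h : IsRegularField F ρ μ zs) (hμ : 0 ≤ μ) (z v : Vec d) :
    0 ≤ inner ℝ (fderiv ℝ F z v) v :=
  le_trans (by positivity) (h.inner_fderiv_ge z v)

/-- Justifies the halting test: strong monotonicity and Cauchy–Schwarz turn a small residual into a
small distance. -/
theorem norm_sub_root_le (h : IsRegularField F ρ μ zs) (hμ : 0 < μ) {w : Vec d} {ε : ℝ}
    (hw : ‖F w‖ ≤ μ * ε) : ‖w - zs‖ ≤ ε := by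
  have h1 := h.monotone w zs
  rw [h.root, sub_zero] at h1
  have h2 := real_inner_le_norm (F w) (w - zs)
  have h3 : μ * ‖w - zs‖ * ‖w - zs‖ ≤ μ * ε * ‖w - zs‖ := by
    calc μ * ‖w - zs‖ * ‖w - zs‖ = μ * ‖w - zs‖ ^ 2 := by ring
      _ ≤ ‖F w‖ * ‖w - zs‖ := h1.trans h2
      _ ≤ _ := mul_le_mul_of_nonneg_right hw (norm_nonneg _)
  rcases (norm_nonneg (w - zs)).eq_or_lt with h0 | h0
  · rw [← h0]
    exact nonneg_of_mul_nonneg_right ((norm_nonneg _).trans hw) hμ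
  · exact le_of_mul_le_mul_left (le_of_mul_le_mul_right h3 h0) hμ

end IsRegularField

/-! ### The GDA field -/

section Blocks

variable {dx dy : ℕ}

theorem inner_eq_parts (u v : Vec (dx + dy)) :
    inner ℝ u v = inner ℝ (xPart u) (xPart v) + inner ℝ (yPart u) (yPart v) := by
  simp [PiLp.inner_apply, Fin.sum_univ_add, xPart, yPart]

theorem norm_sq_eq_parts (u : Vec (dx + dy)) :
    ‖u‖ ^ 2 = ‖xPart u‖ ^ 2 + ‖yPart u‖ ^ 2 := by
  simp only [← real_inner_self_eq_norm_sq, inner_eq_parts u u]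

theorem xPart_sub (u v : Vec (dx + dy)) : xPart (u - v) = xPart u - xPart v := rfl

theorem yPart_sub (u v : Vec (dx + dy)) : yPart (u - v) = yPart u - yPart v := rfl

/-- The aggregated variable `(x, y)`. -/
def joinParts (x : Vec dx) (y : Vec dy) : Vec (dx + dy) := WithLp.toLp 2 (Fin.append x.ofLp y.ofLp)

@[simp] theorem xPart_joinParts (x : Vec dx) (y : Vec dy) : xPart (joinParts x y) = x := by
  ext i; simp [xPart, joinParts]

@[simp] theorem yPart_joinParts (x : Vec dx) (y : Vec dy) : yPart (joinParts x y) = y := by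
  ext i; simp [yPart, joinParts]

theorem ext_parts {u v : Vec (dx + dy)} (hx : xPart u = xPart v) (hy : yPart u = yPart v) :
    u = v := by
  ext i
  refine Fin.addCases (fun i => ?_) (fun j => ?_) i
  · exact congrFun (congrArg WithLp.ofLp hx) i
  · exact congrFun (congrArg WithLp.ofLp hy) j

theorem joinParts_parts (z : Vec (dx + dy)) : joinParts (xPart z) (yPart z) = z :=
  ext_parts (by simp) (by simp)

/-- The inclusion `x ↦ (x, 0)`. -/
def inclX : Vec dx →L[ℝ] Vec (dx + dy) :=
  LinearMap.toContinuousLinearMap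
    { toFun := fun x => joinParts x 0
      map_add' := fun x x' => by
        apply ext_parts
        · rw [xPart_joinParts]; change _ = xPart (joinParts x 0) + xPart (joinParts x' 0); simp
        · rw [yPart_joinParts]; change _ = yPart (joinParts x 0) + yPart (joinParts x' 0); simp
      map_smul' := fun c x => by
        apply ext_parts
        · rw [xPart_joinParts]; change _ = c • xPart (joinParts x 0); simp
        · rw [yPart_joinParts]; change _ = c • yPart (joinParts x 0); simp }

/-- The inclusion `y ↦ (0, y)`. -/
def inclY : Vec dy →L[ℝ] Vec (dx + dy) :=
  LinearMap.toContinuousLinearMap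
    { toFun := fun y => joinParts 0 y
      map_add' := fun y y' => by
        apply ext_parts
        · rw [xPart_joinParts]; change _ = xPart (joinParts 0 y) + xPart (joinParts 0 y'); simp
        · rw [yPart_joinParts]; change _ = yPart (joinParts 0 y) + yPart (joinParts 0 y'); simp
      map_smul' := fun c y => by
        apply ext_parts
        · rw [xPart_joinParts]; change _ = c • xPart (joinParts 0 y); simp
        · rw [yPart_joinParts]; change _ = c • yPart (joinParts 0 y); simp }

theorem joinParts_eq (x : Vec dx) (y : Vec dy) : joinParts x y = inclX x + inclY y := by
  apply ext_parts
  · change _ = xPart (joinParts x 0) + xPart (joinParts 0 y); simp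
  · change _ = yPart (joinParts x 0) + yPart (joinParts 0 y); simp

theorem inclX_single (i : Fin dx) :
    inclX (dy := dy) (EuclideanSpace.single i 1) = EuclideanSpace.single (Fin.castAdd dy i) 1 := by
  change joinParts _ _ = _
  apply ext_parts
  · rw [xPart_joinParts]; ext k; simp [xPart]
  · rw [yPart_joinParts]; ext k; simp [yPart, Fin.ext_iff]; omega

theorem inclY_single (j : Fin dy) :
    inclY (dx := dx) (EuclideanSpace.single j 1) = EuclideanSpace.single (Fin.natAdd dx j) 1 := by
  change joinParts _ _ = _
  apply ext_parts
  · rw [xPart_joinParts]; ext k; simp [xPart, Fin.ext_iff]; omega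
  · rw [yPart_joinParts]; ext k; simp [yPart]

theorem gradient_apply {n : ℕ} (g : Vec n → ℝ) (x : Vec n) (i : Fin n) :
    gradient g x i = fderiv ℝ g x (EuclideanSpace.single i 1) := by
  rw [gradient, ← InnerProductSpace.toDual_symm_apply, EuclideanSpace.inner_single_right]
  simp

/-- The reflection `(x, y) ↦ (x, -y)`. -/
def reflectY : Vec (dx + dy) →ₗᵢ[ℝ] Vec (dx + dy) where
  toFun v := joinParts (xPart v) (-yPart v)
  map_add' u v := by
    apply ext_parts
    · rw [xPart_joinParts]
      change _ = xPart (joinParts _ _) + xPart (joinParts _ _)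
      simp only [xPart_joinParts]; rfl
    · rw [yPart_joinParts]
      change _ = yPart (joinParts _ _) + yPart (joinParts _ _)
      simp only [yPart_joinParts]
      rw [← neg_add]; rfl
  map_smul' c v := by
    apply ext_parts
    · rw [xPart_joinParts]
      change _ = c • xPart (joinParts _ _)
      simp only [xPart_joinParts]; rfl
    · rw [yPart_joinParts]
      change _ = c • yPart (joinParts _ _)
      simp only [yPart_joinParts, smul_neg]; rfl
  norm_map' v := by
    change ‖joinParts (xPart v) (-yPart v)‖ = ‖v‖
    rw [← sq_eq_sq₀ (norm_nonneg _) (norm_nonneg _), norm_sq_eq_parts, norm_sq_eq_parts v]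
    simp

end Blocks

section GDA

variable {dx dy : ℕ} {f : Vec dx → Vec dy → ℝ}

theorem xPart_gdaField (z : Vec (dx + dy)) :
    xPart (gdaField f z) = gradient (fun x => f x (yPart z)) (xPart z) := by
  ext i; simp [xPart, gdaField]

theorem yPart_gdaField (z : Vec (dx + dy)) :
    yPart (gdaField f z) = -gradient (fun y => f (xPart z) y) (yPart z) := by
  ext i; simp [yPart, gdaField]

theorem hasFDerivAt_left (hf : Differentiable ℝ (joint f)) (z : Vec (dx + dy)) :
    HasFDerivAt (fun x => f x (yPart z)) ((fderiv ℝ (joint f) z).comp inclX) (xPart z) := by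
  have h1 : (fun x => f x (yPart z)) = fun x => joint f (inclX x + inclY (yPart z)) := by
    funext x; rw [← joinParts_eq]; simp [joint]
  have h2 : z = inclX (xPart z) + inclY (yPart z) := by rw [← joinParts_eq, joinParts_parts]
  rw [h1]
  refine HasFDerivAt.comp (g := joint f) (xPart z) ?_ ((inclX.hasFDerivAt).add_const _)
  rw [← h2]
  exact (hf z).hasFDerivAt

theorem hasFDerivAt_right (hf : Differentiable ℝ (joint f)) (z : Vec (dx + dy)) :
    HasFDerivAt (fun y => f (xPart z) y) ((fderiv ℝ (joint f) z).comp inclY) (yPart z) := by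
  have h1 : (fun y => f (xPart z) y) = fun y => joint f (inclX (xPart z) + inclY y) := by
    funext x; rw [← joinParts_eq]; simp [joint]
  have h2 : z = inclX (xPart z) + inclY (yPart z) := by rw [← joinParts_eq, joinParts_parts]
  rw [h1]
  refine HasFDerivAt.comp (g := joint f) (yPart z) ?_ ((inclY.hasFDerivAt).const_add _)
  rw [← h2]
  exact (hf z).hasFDerivAt

/-- Reflecting the y-block is a linear isometry, so the Lipschitz constant of the Hessian carries
over to the Jacobian of the field. -/
theorem gdaField_eq (hf : Differentiable ℝ (joint f)) :
    gdaField f = fun z => reflectY (gradient (joint f) z) := by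
  funext z
  apply ext_parts
  · change _ = xPart (joinParts _ _)
    rw [xPart_gdaField, xPart_joinParts]
    ext i
    rw [gradient_apply, (hasFDerivAt_left hf z).fderiv, ContinuousLinearMap.comp_apply,
      inclX_single, ← gradient_apply]
    rfl
  · change _ = yPart (joinParts _ _)
    rw [yPart_gdaField, yPart_joinParts]
    congr 1
    ext i
    rw [gradient_apply, (hasFDerivAt_right hf z).fderiv, ContinuousLinearMap.comp_apply,
      inclY_single, ← gradient_apply]
    rfl

theorem differentiable_gradient {n : ℕ} {g : Vec n → ℝ} (hg : ContDiff ℝ 2 g) :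
    Differentiable ℝ (gradient g) := by
  rw [differentiable_euclidean]
  intro i
  simp only [gradient_apply]
  have h1 : Differentiable ℝ (fderiv ℝ g) :=
    (hg.fderiv_right (m := 1) (by norm_num)).differentiable (by norm_num)
  exact h1.clm_apply (differentiable_const _)

/-- Add the four convexity and concavity inequalities along the sides of the rectangle with corners
(x, y), (x', y), (x', y'), (x, y'): the function values cancel. -/
theorem gdaField_monotone {μ : ℝ} (hf : StronglyConvexConcave μ f) (z z' : Vec (dx + dy)) :
    μ * ‖z - z'‖ ^ 2 ≤ inner ℝ (gdaField f z - gdaField f z') (z - z') := by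
  rw [norm_sq_eq_parts, inner_eq_parts]
  simp only [xPart_sub, yPart_sub, xPart_gdaField, yPart_gdaField]
  have h1 := hf.1 (xPart z) (xPart z') (yPart z)
  have h2 := hf.1 (xPart z') (xPart z) (yPart z')
  have h3 := hf.2 (xPart z) (yPart z) (yPart z')
  have h4 := hf.2 (xPart z') (yPart z') (yPart z)
  rw [norm_sub_rev] at h2 h4
  simp only [inner_sub_left, inner_sub_right, inner_neg_left] at h1 h2 h3 h4 ⊢
  rw [real_inner_comm (gradient _ (xPart z)) (xPart z'),
    real_inner_comm (gradient _ (xPart z)) (xPart z)] at h1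
  rw [real_inner_comm (gradient _ (xPart z')) (xPart z'),
    real_inner_comm (gradient _ (xPart z')) (xPart z)] at h2
  rw [real_inner_comm (gradient _ (yPart z)) (yPart z'),
    real_inner_comm (gradient _ (yPart z)) (yPart z)] at h3
  rw [real_inner_comm (gradient _ (yPart z')) (yPart z'),
    real_inner_comm (gradient _ (yPart z')) (yPart z)] at h4
  linarith

theorem gdaField_saddlePoint {zs : Vec (dx + dy)} (hs : IsSaddlePoint f zs) :
    gdaField f zs = 0 := by
  have hx : IsLocalMin (fun x => f x (yPart zs)) (xPart zs) :=
    Filter.Eventually.of_forall fun x => (hs x (yPart zs)).2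
  have hy : IsLocalMax (fun y => f (xPart zs) y) (yPart zs) :=
    Filter.Eventually.of_forall fun y => (hs (xPart zs) y).1
  apply ext_parts
  · rw [xPart_gdaField, gradient, hx.fderiv_eq_zero, map_zero]; rfl
  · rw [yPart_gdaField, gradient, hy.fderiv_eq_zero, map_zero, neg_zero]; rfl

theorem isRegularField_gdaField {ρ μ : ℝ} {zs : Vec (dx + dy)} (hf : ContDiff ℝ 2 (joint f))
    (hρ : HasLipschitzHessian ρ f) (hμ : StronglyConvexConcave μ f) (hs : IsSaddlePoint f zs) :
    IsRegularField (gdaField f) ρ μ zs := by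
  have hF := gdaField_eq (hf.differentiable (by norm_num))
  have hG := differentiable_gradient hf
  refine ⟨?_, fun z z' => ?_, gdaField_monotone hμ, gdaField_saddlePoint hs⟩
  · rw [hF]
    exact reflectY.toContinuousLinearMap.differentiable.comp hG
  · have hD : ∀ z, fderiv ℝ (gdaField f) z =
        reflectY.toContinuousLinearMap.comp (fderiv ℝ (gradient (joint f)) z) := by
      intro z
      rw [hF]
      exact (reflectY.toContinuousLinearMap.hasFDerivAt.comp z (hG z).hasFDerivAt).fderiv
    rw [hD, hD, ← ContinuousLinearMap.comp_sub, LinearIsometry.norm_toContinuousLinearMap_comp]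
    exact hρ z z'

theorem fderiv_gdaField_apply (z v : Vec (dx + dy)) :
    fderiv ℝ (gdaField f) z v = WithLp.toLp 2 ((gdaJacobian f z).mulVec v.ofLp) := by
  have hv : v = ∑ j, v j • EuclideanSpace.single j (1 : ℝ) := by
    ext i; simp [Pi.single_apply]
  conv_lhs => rw [hv, map_sum]
  ext i
  simp [Matrix.mulVec, dotProduct, gdaJacobian, mul_comm]

end GDA

end LEN

namespace LEN

/-! ### Convergence of one epoch -/

/-- A lagged Gronwall inequality: if each `e t` is at most a third of the average of `r + e` over
the last `m` indices, then the sum of squares of `e` is controlled by that of `r`. -/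
theorem sum_sq_le_of_le_window_average {m n : ℕ} (hm : 0 < m) {r e : ℕ → ℝ}
    (he : ∀ t, 0 ≤ e t)
    (h : ∀ t < n, e t ≤ 1 / (3 * m) *
      ∑ i ∈ (Finset.range n).filter (fun i => i ≤ t ∧ t < i + m), (r i + e i)) :
    7 * ∑ t ∈ Finset.range n, e t ^ 2 ≤ 2 * ∑ t ∈ Finset.range n, r t ^ 2 := by
  have hm' : (0 : ℝ) < m := by exact_mod_cast hm
  have hcard : ∀ t, (((Finset.range n).filter (fun i => i ≤ t ∧ t < i + m)).card : ℝ) ≤ m := by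
    intro t
    have hsub : (Finset.range n).filter (fun i => i ≤ t ∧ t < i + m) ⊆
        Finset.Icc (t + 1 - m) t := by
      intro i hi
      simp only [Finset.mem_filter, Finset.mem_range, Finset.mem_Icc] at hi ⊢
      omega
    have := Finset.card_le_card hsub
    rw [Nat.card_Icc] at this
    exact_mod_cast this.trans (by omega)
  have hcard' : ∀ i, (((Finset.range n).filter (fun t => i ≤ t ∧ t < i + m)).card : ℝ) ≤ m := by
    intro i
    have hsub : (Finset.range n).filter (fun t => i ≤ t ∧ t < i + m) ⊆ Finset.Ico i (i + m) := by
      intro t ht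
      simp only [Finset.mem_filter, Finset.mem_Ico] at ht ⊢
      exact ht.2
    have := Finset.card_le_card hsub
    rw [Nat.card_Ico] at this
    exact_mod_cast this.trans (by omega)
  -- Cauchy–Schwarz over the at most m indices of the window, then (r + e)² ≤ 2(r² + e²).
  have hsq : ∀ t < n, e t ^ 2 ≤ 2 / (9 * m) *
      ∑ i ∈ (Finset.range n).filter (fun i => i ≤ t ∧ t < i + m), (r i ^ 2 + e i ^ 2) := by
    intro t ht
    set s := (Finset.range n).filter (fun i => i ≤ t ∧ t < i + m)
    calc e t ^ 2 ≤ (1 / (3 * m) * ∑ i ∈ s, (r i + e i)) ^ 2 :=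
          pow_le_pow_left₀ (he t) (h t ht) 2
      _ = 1 / (9 * m ^ 2) * (∑ i ∈ s, (r i + e i)) ^ 2 := by
          rw [mul_pow]; congr 1; field_simp; norm_num
      _ ≤ 1 / (9 * m ^ 2) * (m * ∑ i ∈ s, 2 * (r i ^ 2 + e i ^ 2)) := by
          refine mul_le_mul_of_nonneg_left ?_ (by positivity)
          refine sq_sum_le_card_mul_sum_sq.trans ?_
          refine mul_le_mul (hcard t) (Finset.sum_le_sum fun i _ => ?_)
            (Finset.sum_nonneg fun i _ => sq_nonneg _) hm'.le
          nlinarith [sq_nonneg (r i - e i)]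
      _ = _ := by rw [← Finset.mul_sum]; field_simp
  -- After exchanging the sums, each i is counted by at most m values of t. Together with the
  -- previous bound, E ≤ (2/9)(R + E) for the two sums of squares, that is 7E ≤ 2R.
  have hswap : ∑ t ∈ Finset.range n,
      ∑ i ∈ (Finset.range n).filter (fun i => i ≤ t ∧ t < i + m), (r i ^ 2 + e i ^ 2) ≤
      m * ∑ i ∈ Finset.range n, (r i ^ 2 + e i ^ 2) := by
    simp only [Finset.sum_filter]
    rw [Finset.sum_comm, Finset.mul_sum]
    refine Finset.sum_le_sum fun i _ => ?_
    rw [← Finset.sum_filter, Finset.sum_const, nsmul_eq_mul]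
    exact mul_le_mul_of_nonneg_right (hcard' i) (by positivity)
  have hsum := Finset.sum_le_sum fun t (ht : t ∈ Finset.range n) => hsq t (Finset.mem_range.1 ht)
  rw [← Finset.mul_sum] at hsum
  have h1 := hsum.trans (mul_le_mul_of_nonneg_left hswap (by positivity))
  have h2 : 2 / (9 * (m : ℝ)) * (m * ∑ i ∈ Finset.range n, (r i ^ 2 + e i ^ 2)) =
      2 / 9 * (∑ i ∈ Finset.range n, r i ^ 2 + ∑ i ∈ Finset.range n, e i ^ 2) := by
    rw [Finset.sum_add_distrib]; field_simp
  linarith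

/-- The first `n` iterations of LEN: iterates `z`, half steps `w` and step sizes `η`. -/
structure IsTrajectory {d : ℕ} (F : Vec d → Vec d) (M α : ℝ) (m n : ℕ) (z w : ℕ → Vec d)
    (η : ℕ → ℝ) : Prop where
  pos : ∀ t < n, 0 < η t
  newton : ∀ t < n, IsNewtonStep (fderiv ℝ F (z (t - t % m))) (z t) (F (z t)) (η t) (w t)
  lower : ∀ t < n, 1 / (α * M) ≤ η t * ‖w t - z t‖
  upper : ∀ t < n, η t * ‖w t - z t‖ ≤ 1 / M
  next : ∀ t < n, z (t + 1) = z t - η t • F (w t)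

namespace IsTrajectory

variable {d : ℕ} {F : Vec d → Vec d} {M α ρ μ : ℝ} {zs : Vec d} {m n : ℕ} {z w : ℕ → Vec d}
  {η : ℕ → ℝ}

theorem mono (h : IsTrajectory F M α m n z w η) {k : ℕ} (hk : k ≤ n) :
    IsTrajectory F M α m k z w η :=
  ⟨fun t ht => h.pos t (ht.trans_le hk), fun t ht => h.newton t (ht.trans_le hk),
    fun t ht => h.lower t (ht.trans_le hk), fun t ht => h.upper t (ht.trans_le hk),
    fun t ht => h.next t (ht.trans_le hk)⟩

/-- By the Newton equation the corrector displacement is -η times a linearization error about the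
snapshot. The choice M = 3ρm then cancels ρ and leaves the factor 1/(3m). -/
theorem norm_next_sub_le (h : IsTrajectory F (3 * ρ * m) α m n z w η)
    (hF : IsRegularField F ρ μ zs) (hρ : 0 < ρ) (hm : 0 < m) {t : ℕ} (ht : t < n) :
    ‖z (t + 1) - w t‖ ≤ 1 / (3 * m) *
      ∑ i ∈ (Finset.range n).filter (fun i => i ≤ t ∧ t < i + m),
        (‖w i - z i‖ + ‖z (i + 1) - w i‖) := by
  have hm' : (0 : ℝ) < m := by exact_mod_cast hm
  have hη := h.pos t ht
  set p := t - t % m with hp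
  have hpt : p ≤ t := Nat.sub_le _ _
  set A := fderiv ℝ F (z p)
  set R := ‖z t - z p‖ + ‖w t - z t‖ with hR
  have hRle : R ≤ ∑ i ∈ (Finset.range n).filter (fun i => i ≤ t ∧ t < i + m),
      (‖w i - z i‖ + ‖z (i + 1) - w i‖) := by
    have h1 : ‖z t - z p‖ ≤ ∑ i ∈ Finset.Ico p t, (‖w i - z i‖ + ‖z (i + 1) - w i‖) := by
      have := dist_le_Ico_sum_dist z hpt
      rw [dist_comm, dist_eq_norm] at this
      refine this.trans (Finset.sum_le_sum fun i _ => ?_)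
      rw [dist_comm, dist_eq_norm, ← sub_add_sub_cancel (z (i + 1)) (w i) (z i), add_comm]
      exact norm_add_le _ _
    have h2 : R ≤ ∑ i ∈ Finset.Ico p (t + 1), (‖w i - z i‖ + ‖z (i + 1) - w i‖) := by
      rw [Finset.sum_Ico_succ_top hpt]
      linarith [norm_nonneg (z (t + 1) - w t)]
    -- The indices since the snapshot are enlarged to the sliding window of length m, which, unlike
    -- them, has a form suited to counting in either index.
    refine h2.trans (Finset.sum_le_sum_of_subset_of_nonneg ?_ fun _ _ _ => by positivity)
    intro i hi
    have := Nat.mod_lt t hm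
    simp only [Finset.mem_filter, Finset.mem_range, Finset.mem_Ico] at hi ⊢
    omega
  have hlin := hF.norm_linearization_le hρ.le (p := z p) (z := z t) (w := w t) (R := R)
    (by linarith [norm_nonneg (w t - z t)])
    (by rw [← sub_add_sub_cancel (w t) (z t) (z p), hR, add_comm ‖z t - z p‖]
        exact norm_add_le _ _)
  have heq : z (t + 1) - w t = -(η t • (F (w t) - F (z t) - A (w t - z t))) := by
    have hn : A (w t - z t) + (η t)⁻¹ • (w t - z t) = -F (z t) := h.newton t ht
    have h1 : w t - z t = η t • (-F (z t) - A (w t - z t)) := by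
      rw [← hn, add_sub_cancel_left, smul_smul, mul_inv_cancel₀ hη.ne', one_smul]
    calc z (t + 1) - w t = -(η t • F (w t)) - (w t - z t) := by rw [h.next t ht]; abel
      _ = -(η t • F (w t)) - η t • (-F (z t) - A (w t - z t)) := by rw [← h1]
      _ = _ := by simp only [smul_sub, smul_neg]; abel
  have hup := h.upper t ht
  have hR0 : 0 ≤ R := by positivity
  rw [heq, norm_neg, norm_smul, Real.norm_of_nonneg hη.le]
  calc η t * ‖F (w t) - F (z t) - A (w t - z t)‖ ≤ η t * (ρ * R * ‖w t - z t‖) :=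
        mul_le_mul_of_nonneg_left hlin hη.le
    _ = ρ * R * (η t * ‖w t - z t‖) := by ring
    _ ≤ ρ * R * (1 / (3 * ρ * m)) := mul_le_mul_of_nonneg_left hup (by positivity)
    _ = 1 / (3 * m) * R := by field_simp
    _ ≤ _ := mul_le_mul_of_nonneg_left hRle (by positivity)

/-- The extragradient estimate, telescoped. The corrector terms consume 2/7 of the squared steps,
leaving 5/7. -/
theorem energy_le (h : IsTrajectory F (3 * ρ * m) α m n z w η)
    (hF : IsRegularField F ρ μ zs) (hρ : 0 < ρ) (hm : 0 < m) :
    2 * μ * ∑ t ∈ Finset.range n, η t * ‖w t - zs‖ ^ 2 + ‖z n - zs‖ ^ 2 +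
      5 / 7 * ∑ t ∈ Finset.range n, ‖w t - z t‖ ^ 2 ≤ ‖z 0 - zs‖ ^ 2 := by
  have hwin := sum_sq_le_of_le_window_average hm (r := fun t => ‖w t - z t‖)
    (e := fun t => ‖z (t + 1) - w t‖) (fun t => norm_nonneg _)
    (fun t ht => h.norm_next_sub_le hF hρ hm ht)
  -- The right-hand side equals 2η⟨F(w), w - z*⟩ exactly, by expanding the squares with z_{t+1} =
  -- z_t - ηF(w).
  have hstep : ∀ t ∈ Finset.range n, 2 * μ * (η t * ‖w t - zs‖ ^ 2) ≤
      (‖z t - zs‖ ^ 2 - ‖z (t + 1) - zs‖ ^ 2) + ‖z (t + 1) - w t‖ ^ 2 - ‖w t - z t‖ ^ 2 := by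
    intro t ht
    rw [Finset.mem_range] at ht
    have hη := h.pos t ht
    have h1 := hF.monotone (w t) zs
    rw [hF.root, sub_zero] at h1
    have h2 := mul_le_mul_of_nonneg_left h1 hη.le
    rw [h.next t ht]
    set a := z t - zs with ha
    set b := w t - zs with hb
    set g := F (w t)
    have e1 : z t - η t • g - zs = a - η t • g := by rw [ha]; abel
    have e2 : z t - η t • g - w t = (a - b) - η t • g := by rw [ha, hb]; abel
    have e3 : w t - z t = b - a := by rw [ha, hb]; abel
    rw [e1, e2, e3, norm_sub_sq_real a, norm_sub_sq_real (a - b), norm_sub_rev b a,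
      inner_sub_left a b, real_inner_smul_right, real_inner_smul_right]
    rw [real_inner_comm] at h2
    linarith
  have hsum := Finset.sum_le_sum hstep
  rw [← Finset.mul_sum, Finset.sum_sub_distrib, Finset.sum_add_distrib,
    Finset.sum_range_sub' (fun t => ‖z t - zs‖ ^ 2)] at hsum
  linarith

/-- Keeps all iterates, and so all snapshots, in the ball where the binary search bounds are valid.
-/
theorem norm_sub_le (h : IsTrajectory F (3 * ρ * m) α m n z w η) (hF : IsRegularField F ρ μ zs)
    (hρ : 0 < ρ) (hμ : 0 < μ) (hm : 0 < m) {t : ℕ} (ht : t ≤ n) :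
    ‖z t - zs‖ ≤ ‖z 0 - zs‖ := by
  have h1 := (h.mono ht).energy_le hF hρ hm
  have h2 : 0 ≤ ∑ i ∈ Finset.range t, η i * ‖w i - zs‖ ^ 2 :=
    Finset.sum_nonneg fun i hi => mul_nonneg
      ((h.mono ht).pos i (Finset.mem_range.1 hi)).le (sq_nonneg _)
  have h3 : 0 ≤ ∑ i ∈ Finset.range t, ‖w i - z i‖ ^ 2 :=
    Finset.sum_nonneg fun i _ => sq_nonneg _
  have h4 := mul_nonneg hμ.le h2
  exact le_of_sq_le_sq (by linarith) (norm_nonneg _)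

/-- Jensen's inequality for the squared distance, with weights η, applied to the energy estimate. -/
theorem norm_average_sub_le (h : IsTrajectory F (3 * ρ * m) α m n z w η)
    (hF : IsRegularField F ρ μ zs) (hρ : 0 < ρ) (hμ : 0 < μ) (hm : 0 < m) (hn : 0 < n) :
    2 * μ * (∑ t ∈ Finset.range n, η t) *
      ‖(∑ t ∈ Finset.range n, η t)⁻¹ • ∑ t ∈ Finset.range n, η t • w t - zs‖ ^ 2 ≤
        ‖z 0 - zs‖ ^ 2 - 5 / 7 * ∑ t ∈ Finset.range n, ‖w t - z t‖ ^ 2 := by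
  have hE := h.energy_le hF hρ hm
  set W := ∑ t ∈ Finset.range n, η t with hW
  have hWpos : 0 < W := Finset.sum_pos (fun t ht => h.pos t (Finset.mem_range.1 ht))
    (Finset.nonempty_range_iff.2 hn.ne')
  have hdiff : W⁻¹ • ∑ t ∈ Finset.range n, η t • w t - zs =
      W⁻¹ • ∑ t ∈ Finset.range n, η t • (w t - zs) := by
    simp only [smul_sub, Finset.sum_sub_distrib]
    rw [← Finset.sum_smul, ← hW, smul_smul, inv_mul_cancel₀ hWpos.ne', one_smul]
  have hnorm : ‖∑ t ∈ Finset.range n, η t • (w t - zs)‖ ≤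
      ∑ t ∈ Finset.range n, η t * ‖w t - zs‖ := by
    refine (norm_sum_le _ _).trans_eq (Finset.sum_congr rfl fun t ht => ?_)
    rw [norm_smul, Real.norm_of_nonneg (h.pos t (Finset.mem_range.1 ht)).le]
  have hcs : (∑ t ∈ Finset.range n, η t * ‖w t - zs‖) ^ 2 ≤
      W * ∑ t ∈ Finset.range n, η t * ‖w t - zs‖ ^ 2 :=
    Finset.sum_sq_le_sum_mul_sum_of_sq_le_mul _
      (fun t ht => (h.pos t (Finset.mem_range.1 ht)).le)
      (fun t ht => mul_nonneg (h.pos t (Finset.mem_range.1 ht)).le (sq_nonneg _))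
      (fun t _ => le_of_eq (by ring))
  have hsq : W * ‖W⁻¹ • ∑ t ∈ Finset.range n, η t • w t - zs‖ ^ 2 ≤
      ∑ t ∈ Finset.range n, η t * ‖w t - zs‖ ^ 2 := by
    rw [hdiff, norm_smul, norm_inv, Real.norm_of_nonneg hWpos.le]
    have h1 := (pow_le_pow_left₀ (norm_nonneg _) hnorm 2).trans hcs
    calc W * (W⁻¹ * ‖∑ t ∈ Finset.range n, η t • (w t - zs)‖) ^ 2
        = W⁻¹ * ‖∑ t ∈ Finset.range n, η t • (w t - zs)‖ ^ 2 := by field_simp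
      _ ≤ W⁻¹ * (W * ∑ t ∈ Finset.range n, η t * ‖w t - zs‖ ^ 2) :=
          mul_le_mul_of_nonneg_left h1 (inv_nonneg.2 hWpos.le)
      _ = _ := by rw [← mul_assoc, inv_mul_cancel₀ hWpos.ne', one_mul]
  have h2 := mul_le_mul_of_nonneg_left hsq (by positivity : 0 ≤ 2 * μ)
  linarith [sq_nonneg ‖z n - zs‖]

/-- Short steps force large step sizes: `n³ ≤ (α M)² (∑ η)² ∑ ‖w - z‖²`. -/
theorem cube_le (h : IsTrajectory F M α m n z w η) (hM : 0 < M) (hα : 0 < α) :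
    (n : ℝ) ^ 3 ≤ (α * M * ∑ t ∈ Finset.range n, η t) ^ 2 *
      ∑ t ∈ Finset.range n, ‖w t - z t‖ ^ 2 := by
  rcases n.eq_zero_or_pos with rfl | hn
  · simp
  have hn' : (0 : ℝ) < n := by exact_mod_cast hn
  set W := ∑ t ∈ Finset.range n, η t
  set R := ∑ t ∈ Finset.range n, ‖w t - z t‖ with hR
  have hW : 0 ≤ W := Finset.sum_nonneg fun t ht => (h.pos t (Finset.mem_range.1 ht)).le
  have hR0 : 0 ≤ R := Finset.sum_nonneg fun t _ => norm_nonneg _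
  -- Two uses of Cauchy–Schwarz: n² ≤ (∑ η)(∑ η⁻¹) here, and R² ≤ n ∑ ‖w - z‖² below. They are
  -- linked by the acceptance bound η⁻¹ ≤ αM‖w - z‖; squaring and cancelling one n finishes.
  have h1 : (n : ℝ) ^ 2 ≤ W * ∑ t ∈ Finset.range n, (η t)⁻¹ := by
    have := Finset.sum_sq_le_sum_mul_sum_of_sq_le_mul (Finset.range n) (r := fun _ => (1 : ℝ))
      (f := η) (g := fun t => (η t)⁻¹) (fun t ht => (h.pos t (Finset.mem_range.1 ht)).le)
      (fun t ht => (inv_pos.2 (h.pos t (Finset.mem_range.1 ht))).le)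
      (fun t ht => by rw [mul_inv_cancel₀ (h.pos t (Finset.mem_range.1 ht)).ne', one_pow])
    simpa using this
  have h2 : ∑ t ∈ Finset.range n, (η t)⁻¹ ≤ α * M * R := by
    rw [hR, Finset.mul_sum]
    refine Finset.sum_le_sum fun t ht => ?_
    have hη := h.pos t (Finset.mem_range.1 ht)
    have hl := h.lower t (Finset.mem_range.1 ht)
    rw [div_le_iff₀ (by positivity)] at hl
    rw [inv_le_iff_one_le_mul₀ hη]
    linarith
  have h3 : R ^ 2 ≤ n * ∑ t ∈ Finset.range n, ‖w t - z t‖ ^ 2 := by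
    simpa using sq_sum_le_card_mul_sum_sq (s := Finset.range n) (f := fun t => ‖w t - z t‖)
  have h4 : (n : ℝ) ^ 2 ≤ α * M * W * R :=
    h1.trans ((mul_le_mul_of_nonneg_left h2 hW).trans_eq (by ring))
  have h5 := pow_le_pow_left₀ (by positivity) h4 2
  rw [mul_pow _ R] at h5
  have h6 := h5.trans (mul_le_mul_of_nonneg_left h3 (sq_nonneg _))
  refine le_of_mul_le_mul_left ?_ hn'
  linarith

/-- One epoch of `n ≥ (2 M β / μ)^{2/3}` iterations started at distance at most `β` from the root
improves this distance superlinearly. -/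
theorem norm_average_sub_sq_le (h : IsTrajectory F (3 * ρ * m) α m n z w η)
    (hF : IsRegularField F ρ μ zs) (hρ : 0 < ρ) (hμ : 0 < μ) (hm : 0 < m) (hn : 0 < n)
    (hα : 0 < α) {β : ℝ} (hβ : 0 < β) (hnβ : (2 * (3 * ρ * m) * β / μ) ^ 2 ≤ (n : ℝ) ^ 3) :
    ‖(∑ t ∈ Finset.range n, η t)⁻¹ • ∑ t ∈ Finset.range n, η t • w t - zs‖ ^ 2 ≤
      α / 2 * (‖z 0 - zs‖ ^ 3 / β) := by
  have hE := h.norm_average_sub_le hF hρ hμ hm hn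
  have hm' : (0 : ℝ) < m := by exact_mod_cast hm
  have hC := h.cube_le (by positivity) hα
  set W := ∑ t ∈ Finset.range n, η t
  have hWpos : 0 < W := Finset.sum_pos (fun t ht => h.pos t (Finset.mem_range.1 ht))
    (Finset.nonempty_range_iff.2 hn.ne')
  set E := ‖W⁻¹ • ∑ t ∈ Finset.range n, η t • w t - zs‖ ^ 2
  set D := ‖z 0 - zs‖
  have hD : 0 ≤ D := norm_nonneg _
  set S := ∑ t ∈ Finset.range n, ‖w t - z t‖ ^ 2
  have hS0 : 0 ≤ S := Finset.sum_nonneg fun t _ => sq_nonneg _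
  have hE0 : 0 ≤ 2 * μ * W * E := by positivity
  have hS : S ≤ 7 / 5 * D ^ 2 := by linarith
  -- The number 6/5 is a rational upper bound for √(7/5), so that square roots can be taken on both
  -- sides.
  have h1 : (2 * (3 * ρ * m) * β / μ) ^ 2 ≤ (α * (3 * ρ * m) * W * (6 / 5 * D)) ^ 2 := by
    refine hnβ.trans (hC.trans ?_)
    rw [mul_pow _ (6 / 5 * D)]
    refine mul_le_mul_of_nonneg_left (hS.trans ?_) (sq_nonneg _)
    nlinarith [sq_nonneg D]
  have h2 := le_of_sq_le_sq h1 (by positivity)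
  have h3 : 2 * β ≤ α * W * (6 / 5 * D) * μ := by
    rw [div_le_iff₀ hμ] at h2
    refine le_of_mul_le_mul_left ?_ (by positivity : 0 < 3 * ρ * (m : ℝ))
    linarith
  have h4 : 2 * μ * W * E ≤ D ^ 2 := by linarith
  have hE0' : 0 ≤ E := sq_nonneg _
  have h5 : 2 * β * E ≤ 3 / 5 * α * D ^ 3 := by
    calc 2 * β * E ≤ α * W * (6 / 5 * D) * μ * E := mul_le_mul_of_nonneg_right h3 hE0'
      _ = 3 / 5 * α * D * (2 * μ * W * E) := by ring
      _ ≤ 3 / 5 * α * D * D ^ 2 := mul_le_mul_of_nonneg_left h4 (by positivity)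
      _ = _ := by ring
  have h6 : 0 ≤ α * D ^ 3 := by positivity
  rw [← mul_div_assoc, le_div_iff₀ hβ]
  linarith

end IsTrajectory

end LEN

namespace LEN

variable {d : ℕ}

/-! ### The size of regularized Newton steps -/

/-- Pair with v and discard the nonnegative contribution of A. -/
theorem mul_norm_le_norm_add_smul {A : Vec d →L[ℝ] Vec d} (hA : ∀ v, 0 ≤ inner ℝ (A v) v) {γ : ℝ}
    (v : Vec d) : γ * ‖v‖ ≤ ‖A v + γ • v‖ := by
  rcases (norm_nonneg v).eq_or_lt with h0 | h0
  · rw [← h0, mul_zero]; exact norm_nonneg _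
  have h1 := real_inner_le_norm (A v + γ • v) v
  rw [inner_add_left, real_inner_smul_left, real_inner_self_eq_norm_sq] at h1
  refine le_of_mul_le_mul_right ?_ h0
  nlinarith [hA v]

/-- Larger step sizes give longer Newton steps, but not more than proportionally longer ones. -/
theorem IsNewtonStep.norm_le {A : Vec d →L[ℝ] Vec d} (hA : ∀ v, 0 ≤ inner ℝ (A v) v)
    {z b w w' : Vec d} {η η' : ℝ} (hw : IsNewtonStep A z b η w) (hw' : IsNewtonStep A z b η' w')
    (hη : 0 < η) (hle : η ≤ η') :
    ‖w - z‖ ≤ ‖w' - z‖ ∧ η * ‖w' - z‖ ≤ η' * ‖w - z‖ := by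
  have hη' : 0 < η' := hη.trans_le hle
  set x := w - z with hx
  set y := w' - z with hy
  have hγ : η'⁻¹ ≤ η⁻¹ := inv_anti₀ hη hle
  have hγ' : 0 < η'⁻¹ := inv_pos.2 hη'
  have h1 : A (y - x) = η⁻¹ • x - η'⁻¹ • y := by
    have e1 : A x + η⁻¹ • x = -b := hw
    have e2 : A y + η'⁻¹ • y = -b := hw'
    rw [map_sub, eq_sub_of_add_eq e1, eq_sub_of_add_eq e2]
    abel
  have h2 := hA (y - x)
  rw [h1] at h2
  simp only [inner_sub_left, inner_sub_right, real_inner_smul_left,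
    real_inner_self_eq_norm_sq] at h2
  have h3 := real_inner_le_norm x y
  rw [real_inner_comm x y] at h2
  -- Monotonicity tested on y - x, with ⟨x, y⟩ replaced by ‖x‖‖y‖. The two factors have opposite
  -- signs, and each of the two claims is one of these signs.
  have h4 : (‖x‖ - ‖y‖) * (η⁻¹ * ‖x‖ - η'⁻¹ * ‖y‖) ≤ 0 := by
    nlinarith [mul_le_mul_of_nonneg_left h3 (by linarith : 0 ≤ η⁻¹ + η'⁻¹)]
  have h5 : ‖x‖ ≤ ‖y‖ := by
    by_contra! h
    have : 0 < η⁻¹ * ‖x‖ - η'⁻¹ * ‖y‖ := by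
      nlinarith [mul_le_mul_of_nonneg_right hγ (norm_nonneg x), mul_lt_mul_of_pos_left h hγ']
    nlinarith [mul_pos (sub_pos.2 h) this]
  refine ⟨h5, ?_⟩
  have h6 : η'⁻¹ * ‖y‖ ≤ η⁻¹ * ‖x‖ := by
    rcases h5.eq_or_lt with h | h
    · rw [h]; exact mul_le_mul_of_nonneg_right hγ (norm_nonneg _)
    · by_contra! h'
      nlinarith [mul_pos (sub_pos.2 h) (sub_pos.2 h')]
  calc η * ‖y‖ = η * η' * (η'⁻¹ * ‖y‖) := by field_simp
    _ ≤ η * η' * (η⁻¹ * ‖x‖) := mul_le_mul_of_nonneg_left h6 (by positivity)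
    _ = η' * ‖x‖ := by field_simp

section Bounds

variable {F : Vec d → Vec d} {ρ μ η β : ℝ} {zs p z w : Vec d}

/-- Measured from the root, the shifted system has right-hand side η⁻¹(z - z*) minus a linearization
error, because F(z*) = 0. Thus no bound on the Jacobian is needed. -/
theorem IsNewtonStep.norm_step_le (hw : IsNewtonStep (fderiv ℝ F p) z (F z) η w)
    (hF : IsRegularField F ρ μ zs) (hρ : 0 < ρ) (hμ : 0 < μ) (hη : 0 < η) (hz : ‖z - zs‖ ≤ β)
    (hp : ‖p - zs‖ ≤ β) : ‖w - z‖ ≤ 2 * β + 2 * ρ * η * β ^ 2 := by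
  have hβ : 0 ≤ β := (norm_nonneg _).trans hz
  have hlin := hF.norm_linearization_le hρ.le (p := p) (z := zs) (w := z) (R := 2 * β)
    (by rw [norm_sub_rev]; linarith)
    (by rw [← sub_add_sub_cancel z zs p]
        refine (norm_add_le _ _).trans ?_
        rw [norm_sub_rev zs p]; linarith)
  rw [hF.root, sub_zero] at hlin
  set A := fderiv ℝ F p
  have h1 : A (w - z) + η⁻¹ • (w - z) = -F z := hw
  have h2 : A (w - zs) + η⁻¹ • (w - zs) = η⁻¹ • (z - zs) - (F z - A (z - zs)) := by
    rw [← sub_add_sub_cancel w z zs, map_add, smul_add, add_add_add_comm, h1]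
    abel
  have h3 := mul_norm_le_norm_add_smul (hF.inner_fderiv_nonneg hμ.le p) (γ := η⁻¹) (w - zs)
  have h4 : ‖η⁻¹ • (z - zs) - (F z - A (z - zs))‖ ≤ η⁻¹ * β + 2 * ρ * β ^ 2 := by
    refine (norm_sub_le _ _).trans (add_le_add ?_ (hlin.trans ?_))
    · rw [norm_smul, Real.norm_of_nonneg (inv_pos.2 hη).le]
      exact mul_le_mul_of_nonneg_left hz (inv_pos.2 hη).le
    · nlinarith [mul_le_mul_of_nonneg_left hz (by positivity : 0 ≤ ρ * (2 * β))]
  rw [h2] at h3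
  have h5 : ‖w - zs‖ ≤ β + 2 * ρ * η * β ^ 2 := by
    have h6 := mul_le_mul_of_nonneg_left (h3.trans h4) hη.le
    rw [← mul_assoc, mul_inv_cancel₀ hη.ne', one_mul, mul_add, ← mul_assoc,
      mul_inv_cancel₀ hη.ne', one_mul] at h6
    linarith
  have h7 := norm_sub_le (w - zs) (z - zs)
  rw [sub_sub_sub_cancel_right] at h7
  linarith

/-- By the Newton equation, F(w) is a linearization error minus η⁻¹(w - z). A residual above the
tolerance therefore bounds the step length from below. -/
theorem IsNewtonStep.norm_apply_le (hw : IsNewtonStep (fderiv ℝ F p) z (F z) η w)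
    (hF : IsRegularField F ρ μ zs) (hρ : 0 < ρ) (hη : 0 < η) (hz : ‖z - zs‖ ≤ β)
    (hp : ‖p - zs‖ ≤ β) : ‖F w‖ ≤ (η⁻¹ + 2 * ρ * β + ρ * ‖w - z‖) * ‖w - z‖ := by
  have hzp : ‖z - p‖ ≤ 2 * β := by
    rw [← sub_sub_sub_cancel_right z p zs]
    exact (norm_sub_le _ _).trans (by linarith)
  have hlin := hF.norm_linearization_le hρ.le (p := p) (z := z) (w := w) (R := 2 * β + ‖w - z‖)
    (by linarith [norm_nonneg (w - z)])
    (by rw [← sub_add_sub_cancel w z p]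
        exact (norm_add_le _ _).trans (by linarith))
  set A := fderiv ℝ F p
  have h1 : A (w - z) + η⁻¹ • (w - z) = -F z := hw
  have h2 : F w = (F w - F z - A (w - z)) - η⁻¹ • (w - z) := by
    have h3 : F z = -(A (w - z) + η⁻¹ • (w - z)) := by rw [h1, neg_neg]
    rw [h3]; abel
  rw [h2]
  refine (norm_sub_le _ _).trans ?_
  rw [norm_smul, Real.norm_of_nonneg (inv_pos.2 hη).le]
  linarith

end Bounds

/-! ### The binary search -/

/-- `w` and `η` solve the subproblem: `w` is the Newton step with step size `η`, and
`1 / (α M) ≤ η ‖w - z‖ ≤ 1 / M`. -/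
def IsAccepted (A : Vec d →L[ℝ] Vec d) (M α : ℝ) (z b : Vec d) (p : Vec d × ℝ) : Prop :=
  0 < p.2 ∧ IsNewtonStep A z b p.2 p.1 ∧ 1 / (α * M) ≤ p.2 * ‖p.1 - z‖ ∧ p.2 * ‖p.1 - z‖ ≤ 1 / M

theorem log_sqrt_mul_div {a b : ℝ} (ha : 0 < a) (hb : 0 < b) :
    Real.log (√(a * b) / a) = Real.log (b / a) / 2 ∧
      Real.log (b / √(a * b)) = Real.log (b / a) / 2 := by
  have hab : 0 < √(a * b) := Real.sqrt_pos.2 (mul_pos ha hb)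
  rw [Real.log_div hab.ne' ha.ne', Real.log_div hb.ne' ha.ne', Real.log_div hb.ne' hab.ne',
    Real.log_sqrt (mul_pos ha hb).le, Real.log_mul ha.ne' hb.ne']
  constructor <;> ring

/-- Induction on the remaining passes, with the invariant that the end points straddle the
acceptance window. Here k₀ counts the fuel already spent. No continuity of φ is used: a straddling
bracket cannot become too narrow, so some trial is accepted. -/
theorem bisection_spec {P : Config d} (hα : 1 < P.α) (hM : 0 < P.M) (hd : 0 < d)
    {A : Vec d →L[ℝ] Vec d} (hA : ∀ v, 0 ≤ inner ℝ (A v) v) {Q U : CMat d} {z b : Vec d}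
    {H : Vec d → Prop}
    (hN : ∀ η k₀, 0 < η → EventuallyRuns k₀ H (fun _ => newtonStep Q U z b η) (11 * d ^ 2)
      (IsNewtonStep A z b η)) (n : ℕ) :
    ∀ (k₀ : ℕ) (lo hi : ℝ) (wlo whi : Vec d), 0 < lo → lo ≤ hi →
      IsNewtonStep A z b lo wlo → lo * ‖wlo - z‖ ≤ 1 / (P.α * P.M) →
      IsNewtonStep A z b hi whi → 1 / P.M ≤ hi * ‖whi - z‖ →
      Real.log (hi / lo) < 2 ^ n * (Real.log P.α / 2) →
      EventuallyRuns (k₀ + n) H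
        (fun k => bisection { P with fuel := k } Q U z b (k - k₀) lo hi) (n * (23 * d ^ 2))
        (IsAccepted A P.M P.α z b) := by
  have hα0 : 0 < P.α := by linarith
  induction n with
  | zero =>
    intro k₀ lo hi wlo whi hlo hle hwlo hlow hwhi hhigh hlog
    -- With no passes left the logarithm of the ratio is below (log α)/2, but quadratic growth of φ
    -- across the window gives α ≤ (hi/lo)².
    exfalso
    have h1 := (hwlo.norm_le hA hwhi hlo hle).2
    have hhi := hlo.trans_le hle
    have h2 : P.α * lo ^ 2 ≤ hi ^ 2 := by
      have h3 : lo ^ 2 * (1 / P.M) ≤ hi ^ 2 * (1 / (P.α * P.M)) := by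
        calc lo ^ 2 * (1 / P.M) ≤ lo ^ 2 * (hi * ‖whi - z‖) :=
              mul_le_mul_of_nonneg_left hhigh (sq_nonneg _)
          _ = lo * hi * (lo * ‖whi - z‖) := by ring
          _ ≤ lo * hi * (hi * ‖wlo - z‖) := mul_le_mul_of_nonneg_left h1 (by positivity)
          _ = hi ^ 2 * (lo * ‖wlo - z‖) := by ring
          _ ≤ _ := mul_le_mul_of_nonneg_left hlow (sq_nonneg _)
      have h4 := mul_le_mul_of_nonneg_left h3 (by positivity : 0 ≤ P.α * P.M)
      have e1 : P.α * P.M * (lo ^ 2 * (1 / P.M)) = P.α * lo ^ 2 := by field_simp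
      have e2 : P.α * P.M * (hi ^ 2 * (1 / (P.α * P.M))) = hi ^ 2 := by field_simp
      linarith
    have h5 : P.α ≤ (hi / lo) ^ 2 := by rw [div_pow, le_div_iff₀ (by positivity)]; exact h2
    have h6 := Real.log_le_log hα0 h5
    rw [Real.log_pow] at h6
    push_cast at h6
    linarith
  | succ n ih =>
    intro k₀ lo hi wlo whi hlo hle hwlo hlow hwhi hhigh hlog
    have hhi := hlo.trans_le hle
    have hη : 0 < √(lo * hi) := Real.sqrt_pos.2 (mul_pos hlo hhi)
    have hloη : lo ≤ √(lo * hi) := Real.le_sqrt_of_sq_le (by nlinarith)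
    have hηhi : √(lo * hi) ≤ hi := Real.sqrt_le_iff.2 ⟨hhi.le, by nlinarith⟩
    obtain ⟨hl1, hl2⟩ := log_sqrt_mul_div hlo hhi
    have hdd : d ≤ d ^ 2 := by nlinarith
    have hlog' : Real.log (hi / lo) / 2 < 2 ^ n * (Real.log P.α / 2) := by
      rw [pow_succ] at hlog; linarith
    set η := √(lo * hi) with hηdef
    refine EventuallyRuns.congr (p := fun k =>
      bisection { P with fuel := k } Q U z b ((k - (k₀ + 1)) + 1) lo hi) ?_ (fun k hk => by
        rw [show k - k₀ = k - (k₀ + 1) + 1 by omega])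
    simp only [bisection]
    rw [show (n + 1) * (23 * d ^ 2) = 2 + (11 * d ^ 2 + (d + (2 * d + (1 + (1 + (2 + (2 + (1 +
      ((n + 1) * (23 * d ^ 2) - 9 - 11 * d ^ 2 - 3 * d))))))))) by
      rw [add_mul]; omega]
    refine .charge_bind (.bind (hN η _ hη) fun w hw => ?_)
    refine .charge_bind (.charge_bind (.charge_bind (.charge_bind (.charge_bind
      (.charge_bind (.charge_bind (EventuallyRuns.mono_cost (c := n * (23 * d ^ 2)) ?_ ?_)))))))
    · refine .ite (fun h => ?_) (fun h => .ite (fun h' => ?_) fun h' => ?_)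
      · have h := of_decide_eq_true h
        exact EventuallyRuns.mono_cost (c := 0) (.charge ⟨hη, hw, h.1, h.2⟩) (Nat.zero_le _)
      · have h' := of_decide_eq_true h'
        have := ih (k₀ + 1) lo η wlo w hlo hloη hwlo hlow hw h'.le (by rw [hl1]; exact hlog')
        rwa [show k₀ + 1 + n = k₀ + (n + 1) by omega] at this
      · have h : ¬(1 / (P.α * P.M) ≤ η * ‖w - z‖ ∧ η * ‖w - z‖ ≤ 1 / P.M) := by simpa using h
        have h' : ¬ 1 / P.M < η * ‖w - z‖ := by simpa using h'
        have h3 : η * ‖w - z‖ ≤ 1 / (P.α * P.M) := by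
          by_contra! h4
          exact h ⟨h4.le, not_lt.1 h'⟩
        have := ih (k₀ + 1) η hi w whi hη hηhi hw h3 hwhi hhigh (by rw [hl2]; exact hlog')
        rwa [show k₀ + 1 + n = k₀ + (n + 1) by omega] at this
    · rw [add_mul]; omega

end LEN

namespace LEN

variable {d : ℕ}

/-! ### Specifications of the parts of LEN-restart -/

/-- The standing assumptions on a configuration: the oracles belong to a regular field with root
`zs`, the parameters are those of LEN-restart, and `n` passes through a binary search loop suffice
for every starting bracket that occurs within distance `β` of the root. -/
structure IsSetup (P : Config d) (ρ μ ε β : ℝ) (zs : Vec d) (cS n : ℕ) : Prop where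
  field : IsRegularField P.F ρ μ zs
  jacobian : ∀ z v, fderiv ℝ P.F z v = WithLp.toLp 2 ((P.J z).mulVec v.ofLp)
  schur : IsSchurRoutine cS P.schur P.schurCost
  dim_pos : 0 < d
  lag_pos : 0 < P.m
  rho_pos : 0 < ρ
  mu_pos : 0 < μ
  eps_pos : 0 < ε
  beta_pos : 0 < β
  trial_pos : 0 < P.η₀
  one_lt_alpha : 1 < P.α
  alpha_lt_two : P.α < 2
  reg_eq : P.M = 3 * ρ * P.m
  tol_eq : P.tol = μ * ε
  passes_of_long : ∀ r, 0 < r → r ≤ 2 * β + 2 * ρ * P.η₀ * β ^ 2 →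
    Real.log (P.α * P.M * r * P.η₀) < 2 ^ n * (Real.log P.α / 2)
  passes_of_short : ∀ r, 0 < r → r ≤ 2 * β + 2 * ρ * P.η₀ * β ^ 2 →
    μ * ε < (P.η₀⁻¹ + 2 * ρ * β + ρ * r) * r →
    Real.log (1 / (P.M * r * P.η₀)) < 2 ^ n * (Real.log P.α / 2)

/-- The state of LEN, started at `z₀`, after `t` iterations. -/
def IsMemoryAt (P : Config d) (z₀ : Vec d) (t : ℕ) (s : Memory d) : Prop :=
  ∃ (z w : ℕ → Vec d) (η : ℕ → ℝ), IsTrajectory P.F P.M P.α P.m t z w η ∧ z 0 = z₀ ∧ z t = s.z ∧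
    s.acc = ∑ i ∈ Finset.range t, η i • w i ∧ s.weight = ∑ i ∈ Finset.range t, η i ∧
    (t % P.m ≠ 0 → (s.Q, s.U) = P.schur (P.J (z (t - t % P.m))))

/-- The cost of a snapshot in iteration `t`, if there is one. -/
def snapshotCost (P : Config d) (cS t : ℕ) : ℕ :=
  if t % P.m = 0 then P.N * d + cS * d ^ 3 else 0

/-- The cost of an epoch of `T` iterations. -/
def epochCost (P : Config d) (cS n T : ℕ) : ℕ :=
  ∑ i ∈ Finset.range T, snapshotCost P cS i + T * (3 * P.N + (35 + 23 * n) * d ^ 2) + (1 + d)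

/-- An iterate, half step and step size appended to a trajectory. -/
theorem IsTrajectory.extend {F : Vec d → Vec d} {M α : ℝ} {m t : ℕ} {z w : ℕ → Vec d}
    {η : ℕ → ℝ} (h : IsTrajectory F M α m t z w η) {w' : Vec d} {η' : ℝ}
    (hacc : IsAccepted (fderiv ℝ F (z (t - t % m))) M α (z t) (F (z t)) (w', η')) :
    IsTrajectory F M α m (t + 1) (Function.update z (t + 1) (z t - η' • F w'))
      (Function.update w t w') (Function.update η t η') := by
  have hz : ∀ i ≤ t, Function.update z (t + 1) (z t - η' • F w') i = z i := fun i hi =>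
    Function.update_of_ne (by omega) _ _
  have hw : ∀ i < t, Function.update w t w' i = w i := fun i hi =>
    Function.update_of_ne (by omega) _ _
  have hη : ∀ i < t, Function.update η t η' i = η i := fun i hi =>
    Function.update_of_ne (by omega) _ _
  have hcases : ∀ i < t + 1, i < t ∨ i = t := fun i hi => by omega
  refine ⟨fun i hi => ?_, fun i hi => ?_, fun i hi => ?_, fun i hi => ?_, fun i hi => ?_⟩ <;>
    rcases hcases i hi with hi | rfl
  · rw [hη i hi]; exact h.pos i hi
  · rw [Function.update_self]; exact hacc.1
  · rw [hη i hi, hw i hi, hz i hi.le, hz _ ((Nat.sub_le _ _).trans hi.le)]; exact h.newton i hi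
  · rw [Function.update_self, Function.update_self, hz i le_rfl, hz _ (Nat.sub_le _ _)]
    exact hacc.2.1
  · rw [hη i hi, hw i hi, hz i hi.le]; exact h.lower i hi
  · rw [Function.update_self, Function.update_self, hz i le_rfl]; exact hacc.2.2.1
  · rw [hη i hi, hw i hi, hz i hi.le]; exact h.upper i hi
  · rw [Function.update_self, Function.update_self, hz i le_rfl]; exact hacc.2.2.2
  · rw [hη i hi, hw i hi, hz i hi.le, hz (i + 1) hi]; exact h.next i hi
  · rw [Function.update_self, Function.update_self, Function.update_self, hz i le_rfl]

namespace IsSetup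

variable {P : Config d} {ρ μ ε β : ℝ} {zs : Vec d} {cS n : ℕ}

theorem reg_pos (h : IsSetup P ρ μ ε β zs cS n) : 0 < P.M := by
  have := h.rho_pos
  have : (0 : ℝ) < P.m := by exact_mod_cast h.lag_pos
  rw [h.reg_eq]; positivity

theorem newtonStep_spec (h : IsSetup P ρ μ ε β zs cS n) (p z b : Vec d) {η : ℝ} (hη : 0 < η)
    (k₀ : ℕ) (H : Vec d → Prop) :
    EventuallyRuns k₀ H
      (fun _ => newtonStep (P.schur (P.J p)).1 (P.schur (P.J p)).2 z b η) (11 * d ^ 2)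
      (IsNewtonStep (fderiv ℝ P.F p) z b η) :=
  have hS := h.schur (P.J p)
  LEN.newtonStep_spec (h.jacobian p) h.dim_pos (h.field.inner_fderiv_nonneg h.mu_pos.le p) hη
    hS.1 hS.2.1 hS.2.2.1 z b k₀ H

/-- The far end of the starting bracket is never evaluated by the method, yet the invariant of the
search needs a Newton step there. Running the program with a void halting condition supplies one. -/
theorem exists_isNewtonStep (h : IsSetup P ρ μ ε β zs cS n) (p z b : Vec d) {η : ℝ}
    (hη : 0 < η) : ∃ w, IsNewtonStep (fderiv ℝ P.F p) z b η w := by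
  obtain ⟨-, -, -, ⟨w, -, hw⟩ | ⟨-, -, hf⟩⟩ := h.newtonStep_spec p z b hη 0 (fun _ => False)
  · exact ⟨w, hw⟩
  · exact hf.elim

theorem subproblem_spec (h : IsSetup P ρ μ ε β zs cS n) {p z : Vec d} (hz : ‖z - zs‖ ≤ β)
    (hp : ‖p - zs‖ ≤ β) :
    EventuallyRuns n (fun w => ‖w - zs‖ ≤ ε)
      (fun k => subproblem { P with fuel := k } (P.schur (P.J p)).1 (P.schur (P.J p)).2 z (P.F z))
      (P.N + (27 + 23 * n) * d ^ 2) (IsAccepted (fderiv ℝ P.F p) P.M P.α z (P.F z)) := by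
  have hM := h.reg_pos
  have hα := h.one_lt_alpha
  have hα0 : 0 < P.α := by linarith
  have hη := h.trial_pos
  have hd := h.dim_pos
  have hdd : d ≤ d ^ 2 := by nlinarith
  have hA := h.field.inner_fderiv_nonneg h.mu_pos.le p
  have hlu : 1 / (P.α * P.M) < 1 / P.M := by
    apply one_div_lt_one_div_of_lt hM
    nlinarith
  simp only [subproblem, callF]
  have hcost : P.N + (27 + 23 * n) * d ^ 2 = 11 * d ^ 2 + (P.N + (2 * d + (1 +
      ((27 + 23 * n) * d ^ 2 - 11 * d ^ 2 - 2 * d - 1)))) := by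
    rw [add_mul]; omega
  rw [hcost]
  refine .bind (h.newtonStep_spec p z (P.F z) hη _ _) fun w hw => ?_
  refine .charge_bind (.charge_bind (.charge_bind (a := decide (‖P.F w‖ ≤ P.tol)) ?_))
  refine .ite (fun hdone => ?_) fun hdone => ?_
  · have hdone := of_decide_eq_true hdone
    rw [h.tol_eq] at hdone
    exact ⟨⟨.halt w, 0⟩, fun _ _ => rfl, Nat.zero_le _,
      .inr ⟨w, rfl, h.field.norm_sub_root_le h.mu_pos hdone⟩⟩
  have hdone : μ * ε < ‖P.F w‖ := by simpa [h.tol_eq] using hdone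
  have hF := hw.norm_apply_le h.field h.rho_pos hη hz hp
  have hr := hw.norm_step_le h.field h.rho_pos h.mu_pos hη hz hp
  -- A zero step would force F(w) = 0, and the method would have halted.
  have hr0 : 0 < ‖w - z‖ := by
    refine (norm_nonneg _).lt_of_ne fun h0 => ?_
    rw [← h0, mul_zero] at hF
    have := mul_pos h.mu_pos h.eps_pos
    linarith
  have hlong := h.passes_of_long _ hr0 hr
  have hshort := h.passes_of_short _ hr0 hr (hdone.trans_le hF)
  have hcost' : d + (2 * d + (1 + (1 + (2 + (2 + (1 + (3 + n * (23 * d ^ 2)))))))) ≤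
      (27 + 23 * n) * d ^ 2 - 11 * d ^ 2 - 2 * d - 1 := by
    have : n * (23 * d ^ 2) = 23 * n * d ^ 2 := by ring
    rw [add_mul]; omega
  refine EventuallyRuns.mono_cost ?_ hcost'
  refine .charge_bind (.charge_bind (.charge_bind (.charge_bind (.charge_bind
      (.charge_bind (.charge_bind ?_))))))
  set r := ‖w - z‖
  refine .ite (fun hacc => ?_) (fun hacc => .ite (fun hsmall => ?_) fun hsmall => ?_)
  · have hacc := of_decide_eq_true hacc
    exact EventuallyRuns.mono_cost (c := 0) (.charge ⟨hη, hw, hacc.1, hacc.2⟩) (Nat.zero_le _)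
  · have hsmall := of_decide_eq_true hsmall
    have hle : P.η₀ ≤ 1 / (P.M * r) := by
      rw [le_div_iff₀ (by positivity)]
      have h1 := hsmall.trans hlu
      rw [lt_div_iff₀ hM] at h1
      linarith
    have hhi : 0 < 1 / (P.M * r) := by positivity
    obtain ⟨whi, hwhi⟩ := h.exists_isNewtonStep p z (P.F z) hhi
    -- The end point exceeds η₀, so its step is at least as long as the trial step r, and 1/(Mr) · r
    -- = 1/M.
    have hhigh : 1 / P.M ≤ 1 / (P.M * r) * ‖whi - z‖ := by
      have h1 := mul_le_mul_of_nonneg_left (hw.norm_le hA hwhi hη hle).1 hhi.le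
      have h2 : 1 / (P.M * r) * r = 1 / P.M := by field_simp
      exact h2 ▸ h1
    refine EventuallyRuns.mono_cost (.charge_bind ?_) (Nat.add_le_add_right (by norm_num) _)
    have hlog : Real.log (1 / (P.M * r) / P.η₀) < 2 ^ n * (Real.log P.α / 2) := by
      rwa [div_div]
    simpa using bisection_spec hα hM hd hA (fun η k₀ hη => h.newtonStep_spec p z (P.F z) hη k₀ _)
      n 0 P.η₀ _ w whi hη hle hw hsmall.le hwhi hhigh hlog
  · have hacc : ¬(1 / (P.α * P.M) ≤ P.η₀ * r ∧ P.η₀ * r ≤ 1 / P.M) := by simpa using hacc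
    have hsmall : ¬ P.η₀ * r < 1 / (P.α * P.M) := by simpa using hsmall
    have hbig : 1 / P.M < P.η₀ * r := by
      by_contra! h1
      exact hacc ⟨not_lt.1 hsmall, h1⟩
    have hle : 1 / (P.α * P.M * r) ≤ P.η₀ := by
      rw [div_le_iff₀ (by positivity)]
      have h1 := hlu.trans hbig
      rw [div_lt_iff₀ (by positivity)] at h1
      linarith
    have hlo : 0 < 1 / (P.α * P.M * r) := by positivity
    obtain ⟨wlo, hwlo⟩ := h.exists_isNewtonStep p z (P.F z) hlo
    have hlow : 1 / (P.α * P.M * r) * ‖wlo - z‖ ≤ 1 / (P.α * P.M) := by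
      have h1 := mul_le_mul_of_nonneg_left (hwlo.norm_le hA hw hlo hle).1 hlo.le
      have h2 : 1 / (P.α * P.M * r) * r = 1 / (P.α * P.M) := by field_simp
      exact h2 ▸ h1
    refine .charge_bind ?_
    have hlog : Real.log (P.η₀ / (1 / (P.α * P.M * r))) < 2 ^ n * (Real.log P.α / 2) := by
      rwa [div_div_eq_mul_div, div_one, mul_comm]
    simpa using bisection_spec hα hM hd hA (fun η k₀ hη => h.newtonStep_spec p z (P.F z) hη k₀ _)
      n 0 _ P.η₀ wlo w hlo hle hwlo hlow hw hbig.le hlog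

theorem snapshot_spec (h : IsSetup P ρ μ ε β zs cS n) {t : ℕ} {s : Memory d} {p : Vec d}
    (hnew : t % P.m = 0 → p = s.z) (hold : t % P.m ≠ 0 → (s.Q, s.U) = P.schur (P.J p))
    (H : Vec d → Prop) :
    EventuallyRuns n H (fun k => snapshot { P with fuel := k } t s)
      (2 + snapshotCost P cS t) (fun QU => QU = P.schur (P.J p)) := by
  simp only [snapshot, callJ, callSchur]
  refine .charge_bind (a := decide (t % P.m = 0)) ?_
  refine .ite (fun ht => ?_) fun ht => ?_
  · have ht := of_decide_eq_true ht
    rw [hnew ht, snapshotCost, if_pos ht]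
    refine .charge_bind (EventuallyRuns.mono_cost (.charge ?_) (h.schur _).2.2.2)
    rfl
  · have ht : t % P.m ≠ 0 := by simpa using ht
    exact EventuallyRuns.mono_cost (.charge (hold ht)) (Nat.zero_le _)

theorem lenIteration_spec (h : IsSetup P ρ μ ε β zs cS n) {z₀ : Vec d} (hz₀ : ‖z₀ - zs‖ ≤ β)
    {t : ℕ} {s : Memory d} (hs : IsMemoryAt P z₀ t s) :
    EventuallyRuns n (fun w => ‖w - zs‖ ≤ ε) (fun k => lenIteration { P with fuel := k } t s)
      (snapshotCost P cS t + (3 * P.N + (34 + 23 * n) * d ^ 2)) (IsMemoryAt P z₀ (t + 1)) := by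
  obtain ⟨z, w, η, htr, hz0, hzt, hacc, hwt, hQU⟩ := hs
  have hd := h.dim_pos
  have hdd : d ≤ d ^ 2 := by nlinarith
  have hdist : ∀ i ≤ t, ‖z i - zs‖ ≤ β := by
    intro i hi
    rw [h.reg_eq] at htr
    exact (htr.norm_sub_le h.field h.rho_pos h.mu_pos h.lag_pos hi).trans (by rwa [hz0])
  simp only [lenIteration, callF]
  refine EventuallyRuns.mono_cost (c := (2 + snapshotCost P cS t) + (P.N +
    ((P.N + (27 + 23 * n) * d ^ 2) + (P.N + (d + (d + (d + (d + (1 + 0))))))))) ?_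
    (by simp only [add_mul]; omega)
  refine .bind (h.snapshot_spec (p := z (t - t % P.m)) (fun h0 => by rw [h0, Nat.sub_zero, hzt])
    hQU _) ?_
  rintro _ rfl
  refine .charge_bind (.bind (h.subproblem_spec (p := z (t - t % P.m)) (z := s.z)
    (hzt ▸ hdist t le_rfl) (hdist _ (Nat.sub_le _ _))) ?_)
  rintro ⟨w', η'⟩ haccept
  refine .charge_bind (.charge_bind (.charge_bind (.charge_bind (.charge_bind
    (.charge_bind (.charge ?_))))))
  rw [← hzt] at haccept
  refine ⟨_, _, _, htr.extend haccept, ?_, ?_, ?_, ?_, ?_⟩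
  · rw [Function.update_of_ne (by omega), hz0]
  · rw [Function.update_self, hzt]
  · rw [Finset.sum_range_succ, Function.update_self, Function.update_self]
    change s.acc + _ = _
    rw [hacc]
    congr 1
    refine Finset.sum_congr rfl fun i hi => ?_
    rw [Function.update_of_ne (Finset.mem_range.1 hi).ne,
      Function.update_of_ne (Finset.mem_range.1 hi).ne]
  · rw [Finset.sum_range_succ, Function.update_self]
    change s.weight + _ = _
    rw [hwt]
    congr 1
    refine Finset.sum_congr rfl fun i hi => ?_
    rw [Function.update_of_ne (Finset.mem_range.1 hi).ne]
  · intro hne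
    -- As m does not divide t + 1, the quotient by m is unchanged and both iterations share a
    -- snapshot.
    have hmod : t + 1 - (t + 1) % P.m = t - t % P.m := by
      have h1 := Nat.div_add_mod t P.m
      have h2 := Nat.div_add_mod (t + 1) P.m
      have h3 : (t + 1) / P.m = t / P.m := by
        rw [Nat.succ_div, if_neg (fun hdvd => hne (Nat.mod_eq_zero_of_dvd hdvd)), add_zero]
      rw [h3] at h2
      omega
    rw [hmod, Function.update_of_ne (by have := Nat.sub_le t (t % P.m); omega)]

theorem lenLoop_spec (h : IsSetup P ρ μ ε β zs cS n) {z₀ : Vec d} (hz₀ : ‖z₀ - zs‖ ≤ β) (j : ℕ) :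
    ∀ (t : ℕ) (s : Memory d), IsMemoryAt P z₀ t s →
    EventuallyRuns n (fun w => ‖w - zs‖ ≤ ε) (fun k => lenLoop { P with fuel := k } j t s)
      (∑ i ∈ Finset.range j, snapshotCost P cS (t + i) + j * (3 * P.N + (35 + 23 * n) * d ^ 2))
      (IsMemoryAt P z₀ (t + j)) := by
  induction j with
  | zero =>
    intro t s hs
    simp only [lenLoop]
    exact EventuallyRuns.mono_cost (.charge hs) (Nat.zero_le _)
  | succ j ih =>
    intro t s hs
    have hd := h.dim_pos
    have hdd : 1 ≤ d ^ 2 := Nat.one_le_pow _ _ hd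
    simp only [lenLoop]
    refine EventuallyRuns.mono_cost (.bind (h.lenIteration_spec hz₀ hs)
      fun s' hs' => .charge_bind (.mono (ih (t + 1) s' hs') le_rfl fun a ha => ?_)) ?_
    · rwa [show t + (j + 1) = t + 1 + j by omega]
    · rw [Finset.sum_range_succ']
      simp only [add_assoc, add_comm 1, add_zero, add_mul, one_mul]
      omega

theorem len_spec (h : IsSetup P ρ μ ε β zs cS n) {z₀ : Vec d} (hz₀ : ‖z₀ - zs‖ ≤ β) {T : ℕ}
    (hT : 0 < T) (hTβ : (2 * P.M * β / μ) ^ 2 ≤ (T : ℝ) ^ 3) :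
    EventuallyRuns n (fun w => ‖w - zs‖ ≤ ε) (fun k => len { P with fuel := k } T z₀)
      (epochCost P cS n T) (fun w => ‖w - zs‖ ^ 2 ≤ P.α / 2 * (‖z₀ - zs‖ ^ 3 / β)) := by
  simp only [len]
  refine .bind (h.lenLoop_spec hz₀ T 0 ⟨z₀, 0, 0, 0, 0⟩ ?_ |>.mono_cost (by simp)) fun s hs => ?_
  -- The zero matrices in the initial memory are never used: iteration 0 takes a snapshot, and the
  -- invariant constrains the factors only when m does not divide t.
  · refine ⟨fun _ => z₀, fun _ => 0, fun _ => 0, ⟨?_, ?_, ?_, ?_, ?_⟩, rfl, rfl, by simp, by simp,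
      fun hne => absurd (Nat.zero_mod _) hne⟩
    all_goals intro t ht; omega
  refine .charge_bind (.charge ?_)
  obtain ⟨z, w, η, htr, hz0, -, hacc, hwt, -⟩ := hs
  rw [zero_add] at htr hacc hwt
  rw [h.reg_eq] at htr hTβ
  rw [hacc, hwt, ← hz0]
  exact htr.norm_average_sub_sq_le h.field h.rho_pos h.mu_pos h.lag_pos hT
    (by linarith [h.one_lt_alpha]) h.beta_pos hTβ

/-- With q = α/2 and D = βq^e, one epoch gives D'² ≤ β²q^{1+3e}. So e + 1 is multiplied by 3/2, and
e = (3/2)^j - 1 after j epochs. -/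
theorem lenRestart_spec (h : IsSetup P ρ μ ε β zs cS n) {T : ℕ} (hT : 0 < T)
    (hTβ : (2 * P.M * β / μ) ^ 2 ≤ (T : ℝ) ^ 3) (S : ℕ) :
    ∀ (j : ℕ) (z : Vec d), ‖z - zs‖ ≤ β * (P.α / 2) ^ ((3 / 2 : ℝ) ^ j - 1) →
    EventuallyRuns n (fun w => ‖w - zs‖ ≤ ε) (fun k => lenRestart { P with fuel := k } T S z)
      (S * epochCost P cS n T)
      (fun w => ‖w - zs‖ ≤ β * (P.α / 2) ^ ((3 / 2 : ℝ) ^ (j + S) - 1)) := by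
  induction S with
  | zero =>
    intro j z hz
    simp only [lenRestart]
    exact EventuallyRuns.mono_cost (.charge hz) (Nat.zero_le _)
  | succ S ih =>
    intro j z hz
    have hq : 0 < P.α / 2 := by linarith [h.one_lt_alpha]
    have hq1 : P.α / 2 ≤ 1 := by linarith [h.alpha_lt_two]
    have hβ := h.beta_pos
    have hzβ : ‖z - zs‖ ≤ β := hz.trans (mul_le_of_le_one_right hβ.le
      (Real.rpow_le_one hq.le hq1 (sub_nonneg.2 (one_le_pow₀ (by norm_num)))))
    simp only [lenRestart]
    refine EventuallyRuns.mono_cost (.bind (h.len_spec hzβ hT hTβ) fun z' hz' =>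
      .mono (ih (j + 1) z' ?_) le_rfl fun a ha => ?_) (by rw [add_mul, one_mul, add_comm])
    · refine le_of_sq_le_sq (hz'.trans ?_) (by positivity)
      have h1 : ‖z - zs‖ ^ 3 ≤ β ^ 3 * ((P.α / 2) ^ ((3 / 2 : ℝ) ^ j - 1)) ^ 3 := by
        rw [← mul_pow]; exact pow_le_pow_left₀ (norm_nonneg _) hz 3
      calc P.α / 2 * (‖z - zs‖ ^ 3 / β)
          ≤ P.α / 2 * (β ^ 3 * ((P.α / 2) ^ ((3 / 2 : ℝ) ^ j - 1)) ^ 3 / β) := by gcongr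
        _ = β ^ 2 * (P.α / 2 * ((P.α / 2) ^ ((3 / 2 : ℝ) ^ j - 1)) ^ 3) := by field_simp
        _ = β ^ 2 * ((P.α / 2) ^ ((3 / 2 : ℝ) ^ (j + 1) - 1)) ^ 2 := by
            congr 1
            rw [← Real.rpow_natCast _ 3, ← Real.rpow_natCast _ 2, ← Real.rpow_mul hq.le,
              ← Real.rpow_mul hq.le]
            nth_rewrite 1 [← Real.rpow_one (P.α / 2)]
            rw [← Real.rpow_add hq]
            congr 1
            rw [pow_succ]; push_cast; ring
        _ = _ := by ring
    · rwa [show j + (S + 1) = j + 1 + S by omega]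

end IsSetup
end LEN

namespace LEN

/-! ### The total cost -/

theorem le_pow_ceil_logb {b x : ℝ} (hb : 1 < b) (hx : 0 < x) : x ≤ b ^ ⌈Real.logb b x⌉₊ := by
  rw [← Real.rpow_natCast, ← Real.logb_le_iff_le_rpow hb hx]
  exact Nat.le_ceil _

theorem one_lt_log_of_three_le {x : ℝ} (hx : 3 ≤ x) : 1 < Real.log x := by
  rw [Real.lt_log_iff_exp_lt (by linarith)]
  linarith [Real.exp_one_lt_d9]

/-- Source of both doubly logarithmic factors: the number of epochs and the number of passes are
ceilings of this form. -/
theorem ceil_logb_le {b a x : ℝ} (hb : 1 < b) (ha : 0 ≤ a) (hx : 3 ≤ x) :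
    (⌈Real.logb b (1 + a * Real.log x)⌉₊ : ℝ) ≤
      (1 + (Real.log (1 + a) + 1) / Real.log b) * (1 + Real.log (Real.log x)) := by
  have hl := one_lt_log_of_three_le hx
  have hll : 0 < Real.log (Real.log x) := Real.log_pos hl
  have hlb : 0 < Real.log b := Real.log_pos hb
  have hal : 0 ≤ a * Real.log x := by positivity
  have hla : 0 ≤ Real.log (1 + a) := Real.log_nonneg (by linarith)
  have h1 : Real.log (1 + a * Real.log x) ≤ Real.log (1 + a) + Real.log (Real.log x) := by
    rw [← Real.log_mul (by linarith) (by linarith)]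
    exact Real.log_le_log (by linarith) (by nlinarith)
  have h2 : Real.log (1 + a) + Real.log (Real.log x) ≤
      (Real.log (1 + a) + 1) * (1 + Real.log (Real.log x)) := by nlinarith
  have h3 : 0 ≤ Real.logb b (1 + a * Real.log x) := Real.logb_nonneg hb (by linarith)
  refine (Nat.ceil_lt_add_one h3).le.trans ?_
  have h4 : Real.logb b (1 + a * Real.log x) ≤
      (Real.log (1 + a) + 1) / Real.log b * (1 + Real.log (Real.log x)) := by
    rw [Real.logb, div_mul_eq_mul_div]
    exact div_le_div_of_nonneg_right (h1.trans h2) hlb.le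
  linarith

/-- Division by m is injective on the multiples of m. -/
theorem card_multiples_le (m T : ℕ) :
    ((Finset.range T).filter (fun i => i % m = 0)).card ≤ T / m + 1 := by
  rw [← Finset.card_range (T / m + 1)]
  refine Finset.card_le_card_of_injOn (fun i => i / m) (fun i hi => ?_) fun i hi j hj hij => ?_
  · simp only [Finset.coe_filter, Finset.mem_range, Set.mem_ofPred_eq] at hi
    exact Finset.mem_coe.2 (Finset.mem_range.2 (Nat.lt_succ_of_le (Nat.div_le_div_right hi.1.le)))
  · simp only [Finset.coe_filter, Finset.mem_range, Set.mem_ofPred_eq] at hi hj hij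
    rw [← Nat.div_add_mod i m, ← Nat.div_add_mod j m, hi.2, hj.2, hij]

/-- The lower bound on m enters here: T/m + 1 snapshots at O(Nd + d³) amount to (T/c₁ + d) times O(N
+ d²). -/
theorem epochCost_le {d : ℕ} {P : Config d} {cS n T : ℕ} {c₁ : ℝ} (hd : 0 < d) (hm : 0 < P.m)
    (hc₁ : 0 < c₁) (hm₁ : c₁ * d ≤ P.m) :
    (epochCost P cS n T : ℝ) ≤
      ((1 / c₁ + 1) * (cS + 1) + 40 + 23 * n) * ((P.N + (d : ℝ) ^ 2) * (T + d)) := by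
  have hd' : (1 : ℝ) ≤ d := by exact_mod_cast hd
  have hm' : (0 : ℝ) < P.m := by exact_mod_cast hm
  have hsnap : (∑ i ∈ Finset.range T, snapshotCost P cS i : ℕ) ≤
      (T / P.m + 1) * (P.N * d + cS * d ^ 3) := by
    simp only [snapshotCost]
    rw [← Finset.sum_filter, Finset.sum_const, smul_eq_mul]
    exact Nat.mul_le_mul_right _ (card_multiples_le P.m T)
  have hN : (0 : ℝ) ≤ P.N := Nat.cast_nonneg _
  have hcS : (0 : ℝ) ≤ cS := Nat.cast_nonneg _
  have hT : (0 : ℝ) ≤ T := Nat.cast_nonneg _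
  have hn : (0 : ℝ) ≤ n := Nat.cast_nonneg _
  have hdiv : ((T / P.m : ℕ) : ℝ) * d ≤ T / c₁ := by
    refine (mul_le_mul_of_nonneg_right Nat.cast_div_le (by positivity)).trans ?_
    rw [div_mul_eq_mul_div, div_le_div_iff₀ hm' hc₁]
    nlinarith
  have hsnap' : ((∑ i ∈ Finset.range T, snapshotCost P cS i : ℕ) : ℝ) ≤
      (1 / c₁ + 1) * (cS + 1) * ((P.N + (d : ℝ) ^ 2) * (T + d)) := by
    calc ((∑ i ∈ Finset.range T, snapshotCost P cS i : ℕ) : ℝ)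
        ≤ ((T / P.m : ℕ) + 1) * (P.N * d + cS * (d : ℝ) ^ 3) := by exact_mod_cast hsnap
      _ = ((T / P.m : ℕ) * d + d) * (P.N + cS * (d : ℝ) ^ 2) := by ring
      _ ≤ (T / c₁ + d) * (P.N + cS * (d : ℝ) ^ 2) := by gcongr
      _ ≤ ((1 / c₁ + 1) * (T + d)) * ((cS + 1) * (P.N + (d : ℝ) ^ 2)) := by
          have h1 : (0 : ℝ) ≤ 1 / c₁ * d := by positivity
          have h2 : (T : ℝ) / c₁ = 1 / c₁ * T := by ring
          refine mul_le_mul ?_ ?_ (by positivity) (by positivity)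
          · linarith
          · nlinarith [mul_nonneg hcS hN, sq_nonneg (d : ℝ)]
      _ = _ := by ring
  have hrest : (T : ℝ) * (3 * P.N + (35 + 23 * n) * (d : ℝ) ^ 2) + (1 + d) ≤
      (40 + 23 * n) * ((P.N + (d : ℝ) ^ 2) * (T + d)) := by
    have h1 : 3 * P.N + (35 + 23 * n) * (d : ℝ) ^ 2 ≤ (38 + 23 * n) * (P.N + (d : ℝ) ^ 2) := by
      nlinarith [mul_nonneg hn hN, sq_nonneg (d : ℝ)]
    have h2 : (1 : ℝ) ≤ P.N + (d : ℝ) ^ 2 := by nlinarith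
    have h3 := mul_le_mul_of_nonneg_left h1 hT
    have h4 : (d : ℝ) ≤ (P.N + (d : ℝ) ^ 2) * d := le_mul_of_one_le_left (by positivity) h2
    have h5 : 0 ≤ (38 + 23 * (n : ℝ)) * ((P.N + (d : ℝ) ^ 2) * d) := by positivity
    have h6 : 0 ≤ (P.N + (d : ℝ) ^ 2) * T := by positivity
    linarith
  rw [epochCost]
  push_cast at hsnap' ⊢
  linarith

theorem numIters_pos {M β μ : ℝ} (hM : 0 < M) (hβ : 0 < β) (hμ : 0 < μ) :
    0 < numIters M β μ := by
  rw [numIters, Nat.ceil_pos]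
  positivity

theorem sq_le_numIters_pow {M β μ : ℝ} (hM : 0 < M) (hβ : 0 < β) (hμ : 0 < μ) :
    (2 * M * β / μ) ^ 2 ≤ (numIters M β μ : ℝ) ^ 3 := by
  have hx : 0 ≤ 2 * M * β / μ := by positivity
  have h1 : (2 * M * β / μ) ^ 2 = ((2 * M * β / μ) ^ (2 / 3 : ℝ)) ^ 3 := by
    rw [← Real.rpow_natCast _ 3, ← Real.rpow_mul hx, ← Real.rpow_natCast _ 2]
    norm_num
  rw [h1]
  exact pow_le_pow_left₀ (by positivity) (Nat.le_ceil _) 3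

/-- The upper bound on m enters here: M = 3ρm is at most of order ρd, whence the factor d^{2/3}. -/
theorem numIters_add_le {ρ β μ c₂ : ℝ} {m d : ℕ} (hρ : 0 < ρ) (hβ : 0 < β) (hμ : 0 < μ)
    (hd : 0 < d) (hc₂ : 0 ≤ c₂) (hm : (m : ℝ) ≤ c₂ * d) :
    (numIters (3 * ρ * m) β μ : ℝ) + d ≤ (2 + (6 * c₂) ^ (2 / 3 : ℝ)) *
      (d + (d : ℝ) ^ (2 / 3 : ℝ) * (ρ / μ * β) ^ (2 / 3 : ℝ)) := by
  have hd' : (1 : ℝ) ≤ d := by exact_mod_cast hd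
  have h1 : (numIters (3 * ρ * m) β μ : ℝ) ≤ (2 * (3 * ρ * m) * β / μ) ^ (2 / 3 : ℝ) + 1 :=
    (Nat.ceil_lt_add_one (by positivity)).le
  have h2 : (2 * (3 * ρ * m) * β / μ) ^ (2 / 3 : ℝ) ≤
      (6 * c₂) ^ (2 / 3 : ℝ) * ((d : ℝ) ^ (2 / 3 : ℝ) * (ρ / μ * β) ^ (2 / 3 : ℝ)) := by
    rw [← Real.mul_rpow (by positivity) (by positivity),
      ← Real.mul_rpow (by positivity) (by positivity)]
    refine Real.rpow_le_rpow (by positivity) ?_ (by norm_num)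
    calc 2 * (3 * ρ * m) * β / μ = 6 * (m : ℝ) * (ρ / μ * β) := by ring
      _ ≤ 6 * (c₂ * d) * (ρ / μ * β) := by gcongr
      _ = _ := by ring
  have h3 : 0 ≤ (6 * c₂) ^ (2 / 3 : ℝ) * d := by positivity
  have h4 : 0 ≤ (d : ℝ) ^ (2 / 3 : ℝ) * (ρ / μ * β) ^ (2 / 3 : ℝ) := by positivity
  linarith

/-- `numEpochs` epochs of superlinear convergence reach the accuracy `ε`. -/
theorem mul_rpow_numEpochs_le {α β ε : ℝ} (hα : 0 < α) (hα₂ : α < 2) (hβ : 0 < β) (hε : 0 < ε) :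
    β * (α / 2) ^ ((3 / 2 : ℝ) ^ numEpochs α β ε - 1) ≤ ε := by
  have hb : 1 < 2 / α := by rw [lt_div_iff₀ hα]; linarith
  have hmax := le_max_left 0 (Real.logb (2 / α) (β / ε))
  have h1 : Real.logb (2 / α) (β / ε) ≤ (3 / 2 : ℝ) ^ numEpochs α β ε - 1 := by
    have := le_pow_ceil_logb (b := 3 / 2) (by norm_num)
      (by linarith : 0 < 1 + max 0 (Real.logb (2 / α) (β / ε)))
    rw [numEpochs]
    linarith [le_max_right 0 (Real.logb (2 / α) (β / ε))]
  rw [Real.logb_le_iff_le_rpow hb (by positivity)] at h1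
  have h2 : (α / 2) ^ ((3 / 2 : ℝ) ^ numEpochs α β ε - 1) =
      ((2 / α) ^ ((3 / 2 : ℝ) ^ numEpochs α β ε - 1))⁻¹ := by
    rw [← Real.inv_rpow (by positivity), inv_div]
  rw [h2, ← div_eq_mul_inv, div_le_iff₀ (by positivity)]
  rw [div_le_iff₀ hε] at h1
  linarith

theorem numEpochs_le {α β ε x : ℝ} (hα : 0 < α) (hα₂ : α < 2) (hβ : 0 < β) (hε : 0 < ε)
    (hx : 3 ≤ x) (hβx : β ≤ x) (hεx : ε⁻¹ ≤ x) :
    (numEpochs α β ε : ℝ) ≤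
      (1 + (Real.log (1 + 2 / Real.log (2 / α)) + 1) / Real.log (3 / 2)) *
        (1 + Real.log (Real.log x)) := by
  have hb : 0 < Real.log (2 / α) := Real.log_pos (by rw [lt_div_iff₀ hα]; linarith)
  have hl := one_lt_log_of_three_le hx
  refine le_trans ?_ (ceil_logb_le (by norm_num) (by positivity) hx)
  rw [numEpochs, Nat.cast_le]
  refine Nat.ceil_mono (Real.logb_le_logb_of_le (by norm_num) ?_ ?_)
  · linarith [le_max_left 0 (Real.logb (2 / α) (β / ε))]
  · refine add_le_add_right (max_le (by positivity) ?_) _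
    rw [Real.logb, div_mul_eq_mul_div]
    refine div_le_div_of_nonneg_right ?_ hb.le
    have h1 : β / ε ≤ x ^ 2 := by
      rw [div_eq_mul_inv, sq]
      exact mul_le_mul hβx hεx (by positivity) (by linarith)
    refine (Real.log_le_log (by positivity) h1).trans_eq ?_
    rw [Real.log_pow]; norm_num

theorem numEpochs_eq_zero {α β ε : ℝ} (hα : 0 < α) (hα₂ : α < 2) (hβ : 0 ≤ β) (hε : 0 < ε)
    (hle : β ≤ ε) : numEpochs α β ε = 0 := by
  have h : Real.logb (2 / α) (β / ε) ≤ 0 := by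
    refine Real.logb_nonpos (by rw [lt_div_iff₀ hα]; linarith) (by positivity) ?_
    rw [div_le_one hε]; exact hle
  rw [numEpochs, max_eq_left h]
  simp

end LEN

namespace LEN

/-! ### Polynomial bounds in Λ for the starting brackets of the binary search -/

section Brackets

variable {ρ μ ε η₀ β α c x r : ℝ} {m d : ℕ}

theorem step_le_pow (hη : 0 < η₀) (hβ : 0 < β) (hx : 3 ≤ x) (hρx : ρ ≤ x)
    (hηx : η₀ ≤ x) (hβx : β ≤ x) (hr : r ≤ 2 * β + 2 * ρ * η₀ * β ^ 2) : r ≤ 4 * x ^ 4 := by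
  have h1 : 2 * ρ * η₀ * β ^ 2 ≤ 2 * x * x * x ^ 2 := by gcongr
  have h2 : x ^ 1 ≤ x ^ 4 := pow_le_pow_right₀ (by linarith) (by norm_num)
  linarith

theorem bracket_le_of_long (hρ : 0 < ρ) (hη : 0 < η₀) (hβ : 0 < β) (hα₂ : α < 2)
    (hc : 1 ≤ c) (hx : 3 ≤ x) (hρx : ρ ≤ x) (hηx : η₀ ≤ x) (hβx : β ≤ x) (hdx : (d : ℝ) ≤ x)
    (hm : (m : ℝ) ≤ c * d) (hr0 : 0 < r) (hr : r ≤ 2 * β + 2 * ρ * η₀ * β ^ 2) :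
    α * (3 * ρ * m) * r * η₀ ≤ 24 * c * x ^ 9 := by
  have hr4 := step_le_pow hη hβ hx hρx hηx hβx hr
  have hmx : (m : ℝ) ≤ c * x := hm.trans (mul_le_mul_of_nonneg_left hdx (by linarith))
  have h1 : α * (3 * ρ * m) * r * η₀ ≤ 2 * (3 * x * (c * x)) * (4 * x ^ 4) * x := by gcongr
  have h2 : x ^ 7 ≤ x ^ 9 := pow_le_pow_right₀ (by linarith) (by norm_num)
  have h3 := mul_le_mul_of_nonneg_left h2 (by linarith : 0 ≤ 24 * c)
  linarith

/-- The failed halting test bounds r from below: με ≥ x⁻² while its factor is at most 7x⁵, so r⁻¹ ≤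
7x⁷. The remaining two powers of x come from ρ⁻¹ and η₀⁻¹. -/
theorem bracket_le_of_short (hρ : 0 < ρ) (hμ : 0 < μ) (hε : 0 < ε) (hη : 0 < η₀) (hβ : 0 < β)
    (hc : 1 ≤ c) (hx : 3 ≤ x) (hρx : ρ ≤ x) (hρx' : ρ⁻¹ ≤ x) (hμx : μ⁻¹ ≤ x) (hηx : η₀ ≤ x)
    (hηx' : η₀⁻¹ ≤ x) (hβx : β ≤ x) (hεx : ε⁻¹ ≤ x) (hm : 0 < m) (hr0 : 0 < r)
    (hr : r ≤ 2 * β + 2 * ρ * η₀ * β ^ 2)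
    (hlow : μ * ε < (η₀⁻¹ + 2 * ρ * β + ρ * r) * r) :
    1 / (3 * ρ * m * r * η₀) ≤ 24 * c * x ^ 9 := by
  have hr4 := step_le_pow hη hβ hx hρx hηx hβx hr
  have hm' : (1 : ℝ) ≤ m := by exact_mod_cast hm
  have h1 : η₀⁻¹ + 2 * ρ * β + ρ * r ≤ 7 * x ^ 5 := by
    have e1 : 2 * ρ * β ≤ 2 * x * x := by gcongr
    have e2 : ρ * r ≤ x * (4 * x ^ 4) := by gcongr
    have e3 : x ^ 1 ≤ x ^ 5 := pow_le_pow_right₀ (by linarith) (by norm_num)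
    have e4 : x ^ 2 ≤ x ^ 5 := pow_le_pow_right₀ (by linarith) (by norm_num)
    linarith
  have h2 : r⁻¹ ≤ 7 * x ^ 7 := by
    have e1 := hlow.le.trans (mul_le_mul_of_nonneg_right h1 hr0.le)
    rw [inv_le_iff_one_le_mul₀ hr0]
    calc (1 : ℝ) = μ⁻¹ * ε⁻¹ * (μ * ε) := by field_simp
      _ ≤ x * x * (7 * x ^ 5 * r) := by gcongr
      _ = 7 * x ^ 7 * r := by ring
  have hm1 : (m : ℝ)⁻¹ ≤ 1 := inv_le_one_of_one_le₀ hm'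
  calc 1 / (3 * ρ * m * r * η₀) = 1 / 3 * ρ⁻¹ * (m : ℝ)⁻¹ * r⁻¹ * η₀⁻¹ := by field_simp
    _ ≤ 1 / 3 * x * 1 * (7 * x ^ 7) * x := by gcongr
    _ = 7 / 3 * 1 * x ^ 9 := by ring
    _ ≤ 24 * c * x ^ 9 := by gcongr; norm_num

/-- The number of passes through a binary search loop that suffice for starting brackets of ratio
at most `24 c x⁹`. -/
def numPasses (α c x : ℝ) : ℕ :=
  ⌈Real.logb 2 (1 + 2 * (Real.log (24 * c) + 9) / Real.log α * Real.log x)⌉₊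

theorem log_lt_of_bracket_le {y : ℝ} (hα : 1 < α) (hc : 1 ≤ c) (hx : 3 ≤ x) (hy0 : 0 < y)
    (hy : y ≤ 24 * c * x ^ 9) :
    Real.log y < 2 ^ numPasses α c x * (Real.log α / 2) := by
  have hl := one_lt_log_of_three_le hx
  have hlα := Real.log_pos hα
  have hlc : 0 ≤ Real.log (24 * c) := Real.log_nonneg (by linarith)
  have h1 : Real.log y ≤ (Real.log (24 * c) + 9) * Real.log x := by
    refine (Real.log_le_log hy0 hy).trans ?_
    rw [Real.log_mul (by linarith) (by positivity), Real.log_pow]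
    push_cast
    nlinarith
  have h2 : 0 ≤ 2 * (Real.log (24 * c) + 9) / Real.log α * Real.log x := by positivity
  have h3 := le_pow_ceil_logb (b := 2) (by norm_num)
    (by linarith : 0 < 1 + 2 * (Real.log (24 * c) + 9) / Real.log α * Real.log x)
  calc Real.log y ≤ (Real.log (24 * c) + 9) * Real.log x := h1
    _ = 2 * (Real.log (24 * c) + 9) / Real.log α * Real.log x * (Real.log α / 2) := by field_simp
    _ < 2 ^ numPasses α c x * (Real.log α / 2) :=
      mul_lt_mul_of_pos_right (by rw [numPasses]; linarith) (by positivity)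

theorem numPasses_le (hα : 1 < α) (hc : 1 ≤ c) (hx : 3 ≤ x) :
    (numPasses α c x : ℝ) ≤
      (1 + (Real.log (1 + 2 * (Real.log (24 * c) + 9) / Real.log α) + 1) / Real.log 2) *
        (1 + Real.log (Real.log x)) := by
  have hlα := Real.log_pos hα
  have hlc : 0 ≤ Real.log (24 * c) := Real.log_nonneg (by linarith)
  exact ceil_logb_le (by norm_num) (by positivity) hx

end Brackets

theorem EventuallyRuns.terminatesWith {d : ℕ} {P : Config d} {T S k₀ c : ℕ} {z₀ : Vec d}
    {Q : Vec d → Prop}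
    (h : EventuallyRuns k₀ Q (fun k => lenRestart { P with fuel := k } T S z₀) c Q) :
    ∃ z cost, TerminatesWith P T S z₀ z cost ∧ Q z ∧ cost ≤ c := by
  obtain ⟨r, hr, hcost, ⟨z, hz, hQ⟩ | ⟨z, hz, hQ⟩⟩ := h
  all_goals
    refine ⟨z, r.cost, ⟨k₀, fun k hk => ?_⟩, hQ, hcost⟩
    have hr' := hr k hk
    simp only at hr'
    rw [hr', Run.result, hz]
    exact ⟨rfl, rfl⟩

end LEN

/-! ### The complexity bound -/

theorem corollary1 (c₁ c₂ α : ℝ) (cS : ℕ) (hc₁ : 0 < c₁) (hα₁ : 1 < α) (hα₂ : α < 2) :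
    ∃ C : ℝ, 0 < C ∧
      ∀ (dx dy : ℕ) (f : LEN.Vec dx → LEN.Vec dy → ℝ) (ρ μ ε η₀ : ℝ)
        (z₀ zs : LEN.Vec (dx + dy)) (N m : ℕ)
        (schur : Matrix (Fin (dx + dy)) (Fin (dx + dy)) ℝ → LEN.CMat (dx + dy) × LEN.CMat (dx + dy))
        (schurCost : Matrix (Fin (dx + dy)) (Fin (dx + dy)) ℝ → ℕ),
        0 < ρ → 0 < μ → 0 < ε → 0 < η₀ →
        ContDiff ℝ 2 (LEN.joint f) →
        LEN.HasLipschitzHessian ρ f →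
        LEN.StronglyConvexConcave μ f →
        LEN.IsSaddlePoint f zs →
        LEN.IsSchurRoutine cS schur schurCost →
        0 < m → c₁ * ((dx + dy : ℕ) : ℝ) ≤ m → (m : ℝ) ≤ c₂ * ((dx + dy : ℕ) : ℝ) →
        ∃ (z : LEN.Vec (dx + dy)) (cost : ℕ),
          LEN.TerminatesWith
            { F := LEN.gdaField f, J := LEN.gdaJacobian f, N := N, schur := schur,
              schurCost := schurCost, m := m, M := 3 * ρ * m, α := α, η₀ := η₀,
              tol := μ * ε, fuel := 0 }
            (LEN.numIters (3 * ρ * m) ‖z₀ - zs‖ μ) (LEN.numEpochs α ‖z₀ - zs‖ ε) z₀ z cost ∧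
          ‖z - zs‖ ≤ ε ∧
          (cost : ℝ) ≤ C * ((N : ℝ) + ((dx + dy : ℕ) : ℝ) ^ 2) *
            (((dx + dy : ℕ) : ℝ) +
              ((dx + dy : ℕ) : ℝ) ^ (2 / 3 : ℝ) * (ρ / μ * ‖z₀ - zs‖) ^ (2 / 3 : ℝ)) *
            (1 + Real.log (Real.log (3 + ((dx + dy : ℕ) : ℝ) + ρ + ρ⁻¹ + μ⁻¹ + η₀ + η₀⁻¹ +
              ‖z₀ - zs‖ + ε⁻¹))) ^ 2 := by
  have hα0 : 0 < α := by linarith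
  -- Passing to at least 1 makes log(24c) nonnegative, whatever the sign of c₂.
  set c := max c₂ 1 with hc
  have hc1 : 1 ≤ c := le_max_right _ _
  have hlα := Real.log_pos hα₁
  have hl2α : 0 < Real.log (2 / α) := Real.log_pos (by rw [lt_div_iff₀ hα0]; linarith)
  have hlc : 0 ≤ Real.log (24 * c) := Real.log_nonneg (by linarith)
  have hl2 : 0 < Real.log 2 := Real.log_pos (by norm_num)
  have hl32 : 0 < Real.log (3 / 2) := Real.log_pos (by norm_num)
  set κn := 1 + (Real.log (1 + 2 * (Real.log (24 * c) + 9) / Real.log α) + 1) / Real.log 2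
    with hκn
  set κS := 1 + (Real.log (1 + 2 / Real.log (2 / α)) + 1) / Real.log (3 / 2) with hκS
  have hκn0 : 0 < κn := by
    have h1 : 0 ≤ 2 * (Real.log (24 * c) + 9) / Real.log α := by positivity
    have h2 := Real.log_nonneg (by linarith : 1 ≤ 1 + 2 * (Real.log (24 * c) + 9) / Real.log α)
    positivity
  have hκS0 : 0 < κS := by
    have h1 : 0 ≤ 2 / Real.log (2 / α) := by positivity
    have h2 := Real.log_nonneg (by linarith : 1 ≤ 1 + 2 / Real.log (2 / α))
    positivity
  set κT := 2 + (6 * c) ^ (2 / 3 : ℝ) with hκT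
  have hκT0 : 0 < κT := by positivity
  set κe := (1 / c₁ + 1) * (cS + 1) + 40 with hκe
  have hκe0 : 0 < κe := by positivity
  -- The factors account for the epochs, the iterations per epoch, and the work per iteration, where
  -- 23κn comes from the binary search.
  refine ⟨κS * κT * (κe + 23 * κn), by positivity, ?_⟩
  intro dx dy f ρ μ ε η₀ z₀ zs N m schur schurCost hρ hμ hε hη hf hHess hconv hsad hschur hm
    hm₁ hm₂
  have hm' : (0 : ℝ) < m := by exact_mod_cast hm
  have hd : 0 < dx + dy := by
    rcases (dx + dy).eq_zero_or_pos with h0 | h0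
    · rw [h0] at hm₂; simp at hm₂; omega
    · exact h0
  set d : ℝ := ((dx + dy : ℕ) : ℝ) with hddef
  set β := ‖z₀ - zs‖ with hβdef
  have hβ0 : 0 ≤ β := norm_nonneg _
  set x := 3 + d + ρ + ρ⁻¹ + μ⁻¹ + η₀ + η₀⁻¹ + β + ε⁻¹ with hxdef
  have hd0 : (0 : ℝ) ≤ d := Nat.cast_nonneg _
  have hρi := inv_pos.2 hρ
  have hμi := inv_pos.2 hμ
  have hηi := inv_pos.2 hη
  have hεi := inv_pos.2 hε
  have hx : 3 ≤ x := by linarith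
  have hX : 1 ≤ 1 + Real.log (Real.log x) := by
    linarith [Real.log_pos (LEN.one_lt_log_of_three_le hx)]
  set X := 1 + Real.log (Real.log x) with hXdef
  -- If z₀ is already accurate, zero epochs are run at no cost. The other case has β > 0, which the
  -- epoch analysis requires.
  rcases le_or_gt β ε with hβε | hβε
  · rw [LEN.numEpochs_eq_zero hα0 hα₂ hβ0 hε hβε]
    refine ⟨z₀, 0, ⟨0, fun k _ => ⟨rfl, rfl⟩⟩, hβε, ?_⟩
    rw [Nat.cast_zero]
    positivity
  have hβ : 0 < β := hε.trans hβε
  have hmc : (m : ℝ) ≤ c * d := hm₂.trans (mul_le_mul_of_nonneg_right (le_max_left _ _) hd0)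
  set P : LEN.Config (dx + dy) :=
    { F := LEN.gdaField f, J := LEN.gdaJacobian f, N := N, schur := schur,
      schurCost := schurCost, m := m, M := 3 * ρ * m, α := α, η₀ := η₀,
      tol := μ * ε, fuel := 0 } with hP
  set n := LEN.numPasses α c x with hn
  have hsetup : LEN.IsSetup P ρ μ ε β zs cS n :=
    { field := LEN.isRegularField_gdaField hf hHess hconv hsad
      jacobian := LEN.fderiv_gdaField_apply
      schur := hschur
      dim_pos := hd
      lag_pos := hm
      rho_pos := hρ
      mu_pos := hμ
      eps_pos := hε
      beta_pos := hβ
      trial_pos := hη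
      one_lt_alpha := hα₁
      alpha_lt_two := hα₂
      reg_eq := rfl
      tol_eq := rfl
      passes_of_long := fun r hr0 hr => LEN.log_lt_of_bracket_le hα₁ hc1 hx
        (by simp only [hP]; positivity)
        (LEN.bracket_le_of_long hρ hη hβ hα₂ hc1 hx (by linarith) (by linarith) (by linarith)
          (by linarith) hmc hr0 hr)
      passes_of_short := fun r hr0 hr hlow => LEN.log_lt_of_bracket_le hα₁ hc1 hx
        (by simp only [hP]; positivity)
        (LEN.bracket_le_of_short hρ hμ hε hη hβ hc1 hx (by linarith) (by linarith) (by linarith)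
          (by linarith) (by linarith) (by linarith) (by linarith) hm hr0 hr hlow) }
  set T := LEN.numIters (3 * ρ * m) β μ with hT
  set S := LEN.numEpochs α β ε with hS
  have hM : 0 < 3 * ρ * (m : ℝ) := by positivity
  have hrun := hsetup.lenRestart_spec (T := T) (LEN.numIters_pos hM hβ hμ)
    (LEN.sq_le_numIters_pow hM hβ hμ) S 0 z₀ (by simp [hβdef])
  obtain ⟨z, cost, hterm, hz, hcost⟩ := LEN.EventuallyRuns.terminatesWith
    (hrun.mono le_rfl fun w hw => hw.trans (by
      rw [zero_add]; exact LEN.mul_rpow_numEpochs_le hα0 hα₂ hβ hε))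
  refine ⟨z, cost, hterm, hz, ?_⟩
  have hSle : (S : ℝ) ≤ κS * X := LEN.numEpochs_le hα0 hα₂ hβ hε hx (by linarith) (by linarith)
  have hnle : (n : ℝ) ≤ κn * X := LEN.numPasses_le hα₁ hc1 hx
  have hTle : (T : ℝ) + d ≤ κT * (d + d ^ (2 / 3 : ℝ) * (ρ / μ * β) ^ (2 / 3 : ℝ)) :=
    LEN.numIters_add_le hρ hβ hμ hd (by linarith) hmc
  have hepoch : (LEN.epochCost P cS n T : ℝ) ≤
      (κe + 23 * n) * ((N + d ^ 2) * (T + d)) :=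
    LEN.epochCost_le hd hm hc₁ hm₁
  have hκX : κe + 23 * (n : ℝ) ≤ (κe + 23 * κn) * X := by
    have h1 : κe ≤ κe * X := le_mul_of_one_le_right hκe0.le hX
    linarith only [h1, hnle]
  set Y := d + d ^ (2 / 3 : ℝ) * (ρ / μ * β) ^ (2 / 3 : ℝ) with hY
  have hY0 : 0 ≤ Y := by positivity
  calc (cost : ℝ) ≤ S * LEN.epochCost P cS n T := by exact_mod_cast hcost
    _ ≤ (κS * X) * (((κe + 23 * κn) * X) * ((N + d ^ 2) * (κT * Y))) := by
        refine mul_le_mul hSle (hepoch.trans ?_) (Nat.cast_nonneg _) (by positivity)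
        gcongr
    _ = _ := by ring

end
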